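/- For $n\ge 0$ let $\mathbb P^{2[n]}$ be the Hilbert scheme of $n$ points in the complex projective plane (zero-dimensional closed subschemes of length $n$), considered on closed points with its Zariski topology. For $r\ge 1$ put $d_r=\frac{r(r+1)}2$ and $$D_{r-1}=\{Z\in\mathbb P^{2[d_r]} : h^0(\mathscr I_Z(r-1))=1\}\subset \mathbb P^{2[d_r]} .$$ Let $Z\in\mathbb P^{2[n]}$ and $Z'\in\mathbb P^{2[m]}$. We say that $Z'$ is residual to $Z$ via curves of degree $d$, and write $Z'=X\cap Y-Z$, if there are plane curves $X=V(f)$, $Y=V(g)$ of degree $d$ without common component, both containing $Z$, such that the saturated homogeneous ideals satisfy $I_{Z'}=\big((f,g):I_Z\big)$. For $A\subseteq\mathbb P^{2[d_r]}$ let $\mathscr L A\subseteq\mathbb P^{2[d_{r+1}]}$ be the set of all $Z'\in\mathbb P^{2[d_{r+1}]}$ that are residual to some $Z\in A$ via two curves of degree $r+1$. Then for every $r\ge 3$ the families $\mathscr L D_{r-1}$ and $D_r$ in $\mathbb P^{2[d_{r+1}]}$ coincide generically, in the following sense. 1. $\mathscr L D_{r-1}\subseteq D_r$. 2. The general element of $D_r$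 lies in $\mathscr L D_{r-1}$: there is an open set $U\subseteq\mathbb P^{2[d_{r+1}]}$ such that $U\cap D_r$ is dense in $D_r$ and $U\cap D_r\subseteq\mathscr L D_{r-1}$. 3. In particular $\overline{\mathscr L D_{r-1}}=\overline{D_r}$. Moreover, if $Z\in\mathbb P^{2[d_r]}$ and $Z'\in\mathbb P^{2[d_{r+1}]}$ are residual via two curves of degree $r+1$, then $Z\in D_{r-1}$ if and only if $Z'\in D_r$, and likewise $h^0(\mathscr I_Z(r-1))\ge 1$ if and only if $h^0(\mathscr I_{Z'}(r))\ge 1$. -/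

import Mathlib

open MvPolynomial

noncomputable section

namespace PlaneLiaison

/-- The homogeneous coordinate ring `ℂ[x₀, x₁, x₂]` of the complex projective plane. -/
abbrev CoordRing : Type := MvPolynomial (Fin 3) ℂ

/-- The space `H⁰(ℙ², 𝒪(t))` of ternary forms of degree `t`. -/
abbrev Forms (t : ℕ) : Submodule ℂ CoordRing := homogeneousSubmodule (Fin 3) ℂ t

/-- The forms of degree `t` that lie in the ideal `I`, as a subspace of all forms of degree `t`. -/
def formsIn (I : Ideal CoordRing) (t : ℕ) : Submodule ℂ (Forms t) :=
  (I.restrictScalars ℂ).comap (Forms t).subtype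

/-- The set `ℙ^{2[n]}` of closed points of the Hilbert scheme of `n` points in the complex
projective plane. A closed subscheme `Z ⊂ ℙ²` is given by its saturated homogeneous ideal
`⨁ₜ H⁰(ℙ², 𝓘_Z(t))`, and `Z` is zero-dimensional of length `n` (empty if `n = 0`) exactly when
its Hilbert polynomial is the constant `n`. -/
@[ext]
structure HilbPoints (n : ℕ) where
  /-- the saturated homogeneous ideal of the subscheme -/
  ideal : Ideal CoordRing
  homogeneous : ∀ p ∈ ideal, ∀ t : ℕ, homogeneousComponent t p ∈ ideal
  saturated : ∀ p : CoordRing, (∀ i : Fin 3, X i * p ∈ ideal) → p ∈ ideal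
  hilbertPolynomial :
    ∀ᶠ t : ℕ in Filter.atTop, Module.finrank ℂ (Forms t ⧸ formsIn ideal t) = n

/-- `h⁰(𝓘_Z(t))`. -/
def HilbPoints.h0 {n : ℕ} (Z : HilbPoints n) (t : ℕ) : ℕ :=
  Module.finrank ℂ (formsIn Z.ideal t)

/-- The Zariski topology on the vector space of linear maps from forms of degree `t` to `ℂⁿ`: the
coordinates of a map are its matrix entries in the monomial basis, and a set is closed iff it is the
common zero locus of a set of polynomials in these coordinates. -/
@[reducible]
def zariskiHom (t n : ℕ) : TopologicalSpace (Forms t →ₗ[ℂ] (Fin n → ℂ)) :=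
  TopologicalSpace.induced
    (fun φ => pointToPoint (k := ℂ) (K := ℂ)
      (fun e : Fin n × {m : Fin 3 →₀ ℕ // m.degree = t} =>
        φ ⟨monomial e.2.1 1, isHomogeneous_monomial 1 e.2.2⟩ e.1))
    PrimeSpectrum.zariskiTopology

/-- A frame of a length `n` subscheme `Z`: a surjection from the forms of degree `n` onto `ℂⁿ`
whose kernel is `H⁰(𝓘_Z(n))`, that is, a basis of `H⁰(𝒪_Z(n))`. -/
def Frame (n : ℕ) : Type :=
  {p : HilbPoints n × (Forms n →ₗ[ℂ] (Fin n → ℂ)) //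
    Function.Surjective p.2 ∧ LinearMap.ker p.2 = formsIn p.1.ideal n}

/-- The Zariski topology on the closed points of the Hilbert scheme. As `n` is the Gotzmann number
of the Hilbert polynomial `n`, the map `Z ↦ H⁰(𝓘_Z(n))` is Grothendieck's closed embedding of
`ℙ^{2[n]}` into the Grassmannian of codimension `n` subspaces of the forms of degree `n`. The
Grassmannian is the quotient by `GLₙ` of the space of surjections onto `ℂⁿ`, so the Zariski topology
of `ℙ^{2[n]}` is the quotient topology from the space of frames. -/
instance (n : ℕ) : TopologicalSpace (HilbPoints n) :=
  TopologicalSpace.coinduced (fun p : Frame n => p.1.1)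
    (TopologicalSpace.induced (fun p : Frame n => p.1.2) (zariskiHom n n))

/-- The triangular number `d_r = r(r+1)/2`. -/
def tri (r : ℕ) : ℕ := r * (r + 1) / 2

/-- The locus of `Z ∈ ℙ^{2[n]}` with `h⁰(𝓘_Z(t)) = 1`. For `n = d_r` and `t = r - 1` this is
`D_{r-1}`. -/
def locusD (n t : ℕ) : Set (HilbPoints n) := {Z | Z.h0 t = 1}

/-- `Z' = X ∩ Y - Z` for two plane curves `X = V(f)`, `Y = V(g)` of degree `d` without common
component that contain `Z`: the subscheme `Z'` is residual to `Z` in the complete intersection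
`X ∩ Y`, so that its ideal is the ideal quotient `(f, g) : I_Z`. -/
def AreResidual (d : ℕ) {n m : ℕ} (Z : HilbPoints n) (Z' : HilbPoints m) : Prop :=
  ∃ f g : CoordRing, f ≠ 0 ∧ g ≠ 0 ∧ f.IsHomogeneous d ∧ g.IsHomogeneous d ∧ IsRelPrime f g ∧
    f ∈ Z.ideal ∧ g ∈ Z.ideal ∧
    Z'.ideal = (Ideal.span {f, g}).colon (Z.ideal : Set CoordRing)

/-- The residual family `𝓛A ⊆ ℙ^{2[d_{r+1}]}` of a family `A ⊆ ℙ^{2[d_r]}`: all residuals of members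
of `A` in complete intersections of two curves of degree `r + 1`. -/
def residualFamily (r : ℕ) (A : Set (HilbPoints (tri r))) : Set (HilbPoints (tri (r + 1))) :=
  {Z' | ∃ Z ∈ A, AreResidual (r + 1) Z Z'}

end PlaneLiaison

end

noncomputable section

namespace PlaneLiaison

/-! The engine is liaison duality (`liaison`). Let `I` and `J` be linked by coprime forms `f`, `g`
of degrees `a`, `b`, and put `m = a + b - 3`. For `s + t = m`, the failure of the scheme of `J` to
impose independent conditions in degree `t` equals `dim I_s - dim (f,g)_s`. For two curves of degree
`r + 1` take `s = r - 1` and `t = r`: then `(f,g)_s = 0` and the length `d_{r+1}` is the dimension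
of the forms of degree `r`, so `h⁰(𝓘_{Z'}(r)) = h⁰(𝓘_Z(r-1))` (`AreResidual.h0_eq`). This gives the
inclusion and the final equivalences.

The duality is proved on the affine ring `S/(f, g, l - 1)`, for a line `l` missing the intersection.
It has dimension `ab` and is filtered by degree. A functional whose kernel is the hyperplane of
elements of degree at most `m` makes multiplication a perfect pairing, because the socle of
`S/(f,g,l)` sits in degree `m + 1`. Orthogonality exchanges the filtration steps for `s` and `t`,
and exchanges the ideals `I` and `J`.

Linkage is symmetric, so a member of `D_r` is a residual of a member of `D_{r-1}` as soon as it lies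
on two coprime curves of degree `r + 1`. With independent conditions in that degree added, this
defines `goodLocus`; it remains to see that it is open and that it is dense in `D_r`.

Openness (`isOpen_goodLocus`): surjectivity and injectivity of polynomial families of linear maps
are open conditions, and coprimality is an injectivity statement.

Density (`locusD_subset_closure`): link `Z` in `D_r` by its unique curve `f` of degree `r` and a
curve `g` of degree `r + 2` to a scheme of length `d_r - 1` with ideal `K`. That scheme lies on a
single curve `h` of degree `r - 1`, and on some `f'` of degree `r` not divisible by `h`. Link back
by `f + s f'` and `g`. A fixed component of the curves of degree `r + 1` through the new scheme
would have to be a line whose complement in `f + s f'` is a multiple of `h`, which happens for at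
most one `s`. Frames of the new schemes depend polynomially on `s`, so these schemes specialize to
`Z`. -/

instance (t : ℕ) : Module.Finite ℂ (Forms t) :=
  Module.Finite.iff_fg.2 (homogeneousSubmodule_fg (Fin 3) ℂ t)

/-! ### Dimensions of spaces of ternary forms -/

lemma two_mul_tri (r : ℕ) : 2 * tri r = r * (r + 1) :=
  Nat.mul_div_cancel' (Nat.even_mul_succ_self r).two_dvd

lemma tri_succ (r : ℕ) : tri (r + 1) = tri r + (r + 1) := by
  have h1 := two_mul_tri r
  have h2 := two_mul_tri (r + 1)
  nlinarith

@[simp] lemma tri_zero : tri 0 = 0 := rfl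

lemma card_degree_eq (t : ℕ) : Nat.card {m : Fin 3 →₀ ℕ // m.degree = t} = tri (t + 1) := by
  have e : {m : Fin 3 →₀ ℕ // m.degree = t} ≃ Sym (Fin 3) t :=
    (Equiv.subtypeEquivRight fun m => Iff.rfl).trans
      (Sym.equivNatSum (Fin 3) t).symm
  rw [Nat.card_congr e, Nat.card_eq_fintype_card, Sym.card_sym_eq_choose]
  have : 3 + t - 1 = t + 2 := by omega
  simp only [Fintype.card_fin, this]
  rw [Nat.choose_symm_add, Nat.choose_two_right, tri]
  congr 1
  rw [mul_comm]; rfl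

lemma finrank_forms (t : ℕ) : Module.finrank ℂ (Forms t) = tri (t + 1) := by
  rw [← card_degree_eq]
  have hfin : Finite {m : Fin 3 →₀ ℕ // m.degree = t} := by
    apply Nat.finite_of_card_ne_zero
    rw [card_degree_eq, tri_succ]; omega
  have := Fintype.ofFinite {m : Fin 3 →₀ ℕ // m.degree = t}
  have hspan : Forms t = Submodule.span ℂ
      (Set.range fun m : {m : Fin 3 →₀ ℕ // m.degree = t} => (monomial m.1 (1 : ℂ))) := by
    apply le_antisymm
    · intro p hp
      rw [p.as_sum]
      refine Submodule.sum_mem _ fun m hm => ?_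
      have : monomial m (coeff m p) = coeff m p • monomial m (1 : ℂ) := by
        simp [smul_monomial]
      rw [this]
      refine Submodule.smul_mem _ _ (Submodule.subset_span ⟨⟨m, ?_⟩, rfl⟩)
      by_contra h
      exact (mem_support_iff.1 hm) (IsHomogeneous.coeff_eq_zero hp h)
    · rw [Submodule.span_le]
      rintro _ ⟨m, rfl⟩
      exact isHomogeneous_monomial 1 m.2
  rw [hspan, finrank_span_eq_card, Nat.card_eq_fintype_card]
  simpa [Function.comp_def] using
    (basisMonomials (Fin 3) ℂ).linearIndependent.comp
      (fun m : {m : Fin 3 →₀ ℕ // m.degree = t} => m.1) Subtype.val_injective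


/-! ### Graded ideals and homogeneous components -/

/-- The ideal contains the homogeneous components of its members. -/
def IsHomog (I : Ideal CoordRing) : Prop :=
  ∀ p ∈ I, ∀ t : ℕ, homogeneousComponent t p ∈ I

/-- The ideal is saturated with respect to the irrelevant ideal. -/
def IsSat (I : Ideal CoordRing) : Prop :=
  ∀ p : CoordRing, (∀ i : Fin 3, X i * p ∈ I) → p ∈ I

/-- The Hilbert function of `S / I`. -/
def hilb (I : Ideal CoordRing) (t : ℕ) : ℕ := Module.finrank ℂ (Forms t ⧸ formsIn I t)

lemma mem_formsIn {I : Ideal CoordRing} {t : ℕ} {p : Forms t} :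
    p ∈ formsIn I t ↔ (p : CoordRing) ∈ I := Iff.rfl

lemma hilb_add_finrank (I : Ideal CoordRing) (t : ℕ) :
    hilb I t + Module.finrank ℂ (formsIn I t) = tri (t + 1) := by
  rw [← finrank_forms, hilb, Submodule.finrank_quotient_add_finrank]

lemma formsIn_mono {I J : Ideal CoordRing} (h : I ≤ J) (t : ℕ) : formsIn I t ≤ formsIn J t :=
  fun _ hp => h hp

lemma homogeneousComponent_mul {f : CoordRing} {a : ℕ} (hf : f.IsHomogeneous a) (q : CoordRing)
    (t : ℕ) : homogeneousComponent t (f * q) =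
      if a ≤ t then f * homogeneousComponent (t - a) q else 0 := by
  induction q using MvPolynomial.induction_on' with
  | monomial m c =>
    have hm : (monomial m c).IsHomogeneous m.degree := isHomogeneous_monomial c rfl
    rw [homogeneousComponent_of_mem (hf.mul hm), homogeneousComponent_of_mem hm]
    by_cases h : t = a + m.degree
    · subst h; simp
    · split_ifs with h1 h2
      · omega
      · simp
      · rfl
  | add p q hp hq =>
    rw [mul_add, map_add, hp, hq]
    split_ifs
    · rw [map_add, mul_add]
    · simp

lemma homogeneousComponent_mul_add {f : CoordRing} {a : ℕ} (hf : f.IsHomogeneous a)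
    (q : CoordRing) (b : ℕ) :
    homogeneousComponent (a + b) (f * q) = f * homogeneousComponent b q := by
  rw [homogeneousComponent_mul hf]; simp

lemma isHomogeneous_of_mul {f q : CoordRing} {a c : ℕ} (hf : f.IsHomogeneous a) (hf0 : f ≠ 0)
    (hq : q ≠ 0) (h : (f * q).IsHomogeneous c) : ∃ b, c = a + b ∧ q.IsHomogeneous b := by
  have h1 := homogeneousComponent_mul hf q c
  rw [homogeneousComponent_eq_self h] at h1
  split_ifs at h1 with hac
  · refine ⟨c - a, by omega, ?_⟩
    rw [mul_left_cancel₀ hf0 h1]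
    exact homogeneousComponent_isHomogeneous _ _
  · exact absurd h1 (mul_ne_zero hf0 hq)

lemma isHomogeneous_of_mul_add {f q : CoordRing} {a b : ℕ} (hf : f.IsHomogeneous a) (hf0 : f ≠ 0)
    (h : (f * q).IsHomogeneous (a + b)) : q.IsHomogeneous b := by
  by_cases hq : q = 0
  · rw [hq]; exact isHomogeneous_zero _ _ _
  · obtain ⟨b', hb, h'⟩ := isHomogeneous_of_mul hf hf0 hq h
    obtain rfl : b = b' := by omega
    exact h'

/-- The substitution `xᵢ ↦ xᵢ T`. -/
def scale : CoordRing →ₐ[ℂ] Polynomial CoordRing :=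
  aeval fun i => Polynomial.C (X i) * Polynomial.X

lemma scale_monomial (m : Fin 3 →₀ ℕ) (c : ℂ) :
    scale (monomial m c) = Polynomial.monomial m.degree (monomial m c) := by
  rw [scale, aeval_monomial, ← Polynomial.C_mul_X_pow_eq_monomial, monomial_eq, map_mul, mul_assoc]
  have h1 : (m.prod fun i k => (Polynomial.C (X i : CoordRing) * Polynomial.X) ^ k) =
      Polynomial.C (m.prod fun n e => (X n : CoordRing) ^ e) * Polynomial.X ^ m.degree := by
    simp only [Finsupp.prod, mul_pow, Finset.prod_mul_distrib, Finset.prod_pow_eq_pow_sum,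
      map_prod, map_pow]
    rfl
  rw [h1]
  rfl

lemma coeff_scale (q : CoordRing) (t : ℕ) :
    (scale q).coeff t = homogeneousComponent t q := by
  induction q using MvPolynomial.induction_on' with
  | monomial m c =>
    rw [scale_monomial, Polynomial.coeff_monomial,
      homogeneousComponent_of_mem (isHomogeneous_monomial c rfl : (monomial m c).IsHomogeneous _)]
    simp only [eq_comm]
  | add p q hp hq => simp [hp, hq]

lemma scale_ne_zero {q : CoordRing} (hq : q ≠ 0) : scale q ≠ 0 := by
  intro h
  apply hq
  rw [← sum_homogeneousComponent q]
  refine Finset.sum_eq_zero fun i _ => ?_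
  rw [← coeff_scale, h, Polynomial.coeff_zero]

/-- Under `xᵢ ↦ xᵢ T` a form becomes a monomial in `T`. Degree and order in `T` are both additive on
products over a domain, so they must agree on each factor. -/
lemma isHomogeneous_of_dvd {p f : CoordRing} {d : ℕ} (hf : f.IsHomogeneous d) (hf0 : f ≠ 0)
    (h : p ∣ f) : ∃ e, p.IsHomogeneous e := by
  obtain ⟨q, rfl⟩ := h
  have hp0 : p ≠ 0 := left_ne_zero_of_mul hf0
  have hq0 : q ≠ 0 := right_ne_zero_of_mul hf0
  have hs : scale (p * q) = Polynomial.monomial d (p * q) := by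
    ext1 t
    rw [coeff_scale, homogeneousComponent_of_mem hf, Polynomial.coeff_monomial]
    simp only [eq_comm]
  have h1 := Polynomial.natDegree_mul (scale_ne_zero hp0) (scale_ne_zero hq0)
  have h2 := Polynomial.natTrailingDegree_mul (scale_ne_zero hp0) (scale_ne_zero hq0)
  rw [← map_mul, hs] at h1 h2
  rw [Polynomial.natDegree_monomial_eq _ hf0] at h1
  rw [Polynomial.natTrailingDegree_monomial hf0] at h2
  have h3 := Polynomial.natTrailingDegree_le_natDegree (scale p)
  have h4 := Polynomial.natTrailingDegree_le_natDegree (scale q)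
  refine ⟨(scale p).natDegree, ?_⟩
  have : p = homogeneousComponent (scale p).natDegree p := by
    conv_lhs => rw [← sum_homogeneousComponent p]
    have key : ∀ i, i ≠ (scale p).natDegree → homogeneousComponent i p = 0 := by
      intro i hi
      rw [← coeff_scale]
      rcases lt_or_gt_of_ne hi with h | h
      · exact Polynomial.coeff_eq_zero_of_lt_natTrailingDegree (by omega)
      · exact Polynomial.coeff_eq_zero_of_natDegree_lt h
    by_cases hm : (scale p).natDegree ∈ Finset.range (p.totalDegree + 1)
    · rw [Finset.sum_eq_single_of_mem _ hm fun i _ hi => key i hi]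
    · rw [Finset.sum_eq_zero fun i hi => key i (by rintro rfl; exact hm hi)]
      rw [homogeneousComponent_eq_zero]
      simp at hm; omega
  have h5 := homogeneousComponent_isHomogeneous (scale p).natDegree p
  rwa [← this] at h5

lemma IsHomog.mem_of_forall {I : Ideal CoordRing} {p : CoordRing}
    (h : ∀ t, homogeneousComponent t p ∈ I) : p ∈ I := by
  rw [← sum_homogeneousComponent p]
  exact Submodule.sum_mem _ fun i _ => h i

lemma isHomog_span_singleton {f : CoordRing} {a : ℕ} (hf : f.IsHomogeneous a) :
    IsHomog (Ideal.span {f}) := by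
  intro p hp t
  obtain ⟨q, rfl⟩ := Ideal.mem_span_singleton.1 hp
  rw [homogeneousComponent_mul hf]
  split_ifs
  · exact Ideal.mem_span_singleton.2 (dvd_mul_right _ _)
  · exact zero_mem _

lemma IsHomog.sup {I J : Ideal CoordRing} (hI : IsHomog I) (hJ : IsHomog J) :
    IsHomog (I ⊔ J) := by
  intro p hp t
  obtain ⟨i, hi, j, hj, rfl⟩ := Submodule.mem_sup.1 hp
  rw [map_add]
  exact Submodule.add_mem_sup (hI i hi t) (hJ j hj t)

lemma IsHomog.colon {I J : Ideal CoordRing} (hI : IsHomog I) (hJ : IsHomog J) :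
    IsHomog (I.colon (J : Set CoordRing)) := by
  intro p hp t
  rw [Submodule.mem_colon] at hp ⊢
  intro s hs
  rw [smul_eq_mul, ← sum_homogeneousComponent s, Finset.mul_sum]
  refine Submodule.sum_mem _ fun i _ => ?_
  have := hI _ (hp _ (hJ s hs i)) (i + t)
  rwa [smul_eq_mul, mul_comm p,
    homogeneousComponent_mul_add (homogeneousComponent_isHomogeneous i s), mul_comm] at this

lemma IsSat.colon {I : Ideal CoordRing} (hI : IsSat I) (T : Set CoordRing) :
    IsSat (I.colon T) := by
  intro p hp
  rw [Submodule.mem_colon]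
  intro s hs
  refine hI _ fun i => ?_
  have := Submodule.mem_colon.1 (hp i) s hs
  rwa [smul_eq_mul, mul_assoc] at this

lemma span_pair_eq (f g : CoordRing) :
    Ideal.span {f, g} = Ideal.span {f} ⊔ Ideal.span {g} := Ideal.span_insert f {g}

lemma isHomog_span_pair {f g : CoordRing} {a b : ℕ} (hf : f.IsHomogeneous a)
    (hg : g.IsHomogeneous b) : IsHomog (Ideal.span {f, g}) := by
  rw [span_pair_eq]
  exact (isHomog_span_singleton hf).sup (isHomog_span_singleton hg)

lemma formsIn_sup {I J : Ideal CoordRing} (hI : IsHomog I) (hJ : IsHomog J) (t : ℕ) :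
    formsIn (I ⊔ J) t = formsIn I t ⊔ formsIn J t := by
  apply le_antisymm
  · intro p hp
    obtain ⟨i, hi, j, hj, hij⟩ := Submodule.mem_sup.1 (mem_formsIn.1 hp)
    refine Submodule.mem_sup.2 ⟨⟨homogeneousComponent t i, homogeneousComponent_isHomogeneous _ _⟩,
      hI i hi t, ⟨homogeneousComponent t j, homogeneousComponent_isHomogeneous _ _⟩, hJ j hj t, ?_⟩
    apply Subtype.ext
    change homogeneousComponent t i + homogeneousComponent t j = p
    rw [← map_add, hij, homogeneousComponent_eq_self p.2]
  · exact sup_le (formsIn_mono le_sup_left t) (formsIn_mono le_sup_right t)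

/-! ### Ideals generated by one form or by two coprime forms -/

/-- Multiplication by a form, as a map between spaces of forms. -/
def mulForm {a b c : ℕ} (h : a + b = c) : Forms a →ₗ[ℂ] Forms b →ₗ[ℂ] Forms c :=
  LinearMap.mk₂ ℂ (fun f q => ⟨f.1 * q.1, h ▸ IsHomogeneous.mul f.2 q.2⟩)
    (fun _ _ _ => Subtype.ext (add_mul _ _ _)) (fun _ _ _ => Subtype.ext (smul_mul_assoc _ _ _))
    (fun _ _ _ => Subtype.ext (mul_add _ _ _)) (fun _ _ _ => Subtype.ext (mul_smul_comm _ _ _))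

@[simp] lemma coe_mulForm {a b c : ℕ} (h : a + b = c) (f : Forms a) (q : Forms b) :
    (mulForm h f q : CoordRing) = f * q := rfl

lemma mulForm_injective {a b c : ℕ} (h : a + b = c) {f : Forms a} (hf : (f : CoordRing) ≠ 0) :
    Function.Injective (mulForm h f) := fun _ _ hpq =>
  Subtype.ext (mul_left_cancel₀ hf (congrArg Subtype.val hpq))

/-- Multiplication by `f` identifies the piece with the forms of degree `t - a`. Truncated
subtraction and `tri 0 = 0` also cover `t < a`. -/
lemma finrank_formsIn_span_singleton {f : CoordRing} {a : ℕ} (hf : f.IsHomogeneous a)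
    (hf0 : f ≠ 0) (t : ℕ) :
    Module.finrank ℂ (formsIn (Ideal.span {f}) t) = tri (t + 1 - a) := by
  rcases le_or_gt a t with h | h
  · have hat : a + (t - a) = t := by omega
    have : formsIn (Ideal.span {f}) t = LinearMap.range (mulForm hat ⟨f, hf⟩) := by
      ext p
      rw [mem_formsIn, Ideal.mem_span_singleton]
      constructor
      · rintro ⟨q, hq⟩
        have : (f * q).IsHomogeneous (a + (t - a)) := by rw [hat, ← hq]; exact p.2
        exact ⟨⟨q, isHomogeneous_of_mul_add hf hf0 this⟩, Subtype.ext hq.symm⟩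
      · rintro ⟨q, rfl⟩
        exact dvd_mul_right _ _
    rw [this, LinearMap.finrank_range_of_inj (mulForm_injective hat hf0), finrank_forms]
    congr 1; omega
  · have : formsIn (Ideal.span {f}) t = ⊥ := by
      rw [eq_bot_iff]
      intro p hp
      obtain ⟨q, hq⟩ := Ideal.mem_span_singleton.1 (mem_formsIn.1 hp)
      by_cases hq0 : q = 0
      · rw [Submodule.mem_bot]; apply Subtype.ext; rw [hq, hq0, mul_zero]; rfl
      · obtain ⟨b, hb, -⟩ := isHomogeneous_of_mul hf hf0 hq0 (hq ▸ p.2)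
        omega
    rw [this, finrank_bot, Nat.sub_eq_zero_of_le (by omega)]; rfl

/-- The Koszul resolution in the form of inclusion-exclusion: coprimality gives `(f) ∩ (g) = (fg)`.
-/
lemma finrank_formsIn_span_pair {f g : CoordRing} {a b : ℕ} (hf : f.IsHomogeneous a)
    (hg : g.IsHomogeneous b) (hf0 : f ≠ 0) (hg0 : g ≠ 0) (hfg : IsRelPrime f g) (t : ℕ) :
    Module.finrank ℂ (formsIn (Ideal.span {f, g}) t) + tri (t + 1 - (a + b)) =
      tri (t + 1 - a) + tri (t + 1 - b) := by
  rw [span_pair_eq, formsIn_sup (isHomog_span_singleton hf) (isHomog_span_singleton hg),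
    ← finrank_formsIn_span_singleton hf hf0, ← finrank_formsIn_span_singleton hg hg0,
    ← Submodule.finrank_sup_add_finrank_inf_eq,
    ← finrank_formsIn_span_singleton (hf.mul hg) (mul_ne_zero hf0 hg0)]
  have : formsIn (Ideal.span {f * g}) t =
      formsIn (Ideal.span {f}) t ⊓ formsIn (Ideal.span {g}) t := by
   ext p
   rw [Submodule.mem_inf, mem_formsIn, mem_formsIn, mem_formsIn, Ideal.mem_span_singleton,
     Ideal.mem_span_singleton, Ideal.mem_span_singleton]
   exact ⟨fun h => ⟨dvd_of_mul_right_dvd h, dvd_of_mul_left_dvd h⟩, fun h => hfg.mul_dvd h.1 h.2⟩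
  rw [this]

lemma exists_syzygy {f g p q : CoordRing} (hf0 : f ≠ 0) (hfg : IsRelPrime f g)
    (h : p * f + q * g = 0) : ∃ k, p = k * g ∧ q = -(k * f) := by
  have hd : f ∣ q := hfg.dvd_of_dvd_mul_right ⟨-p, by linear_combination h⟩
  obtain ⟨k, rfl⟩ := hd
  refine ⟨-k, mul_left_cancel₀ hf0 ?_, by ring⟩
  linear_combination h

lemma mem_span_X_of_mul {s : Set (Fin 3)} {i : Fin 3} (hi : i ∉ s) {q : CoordRing}
    (h : X i * q ∈ Ideal.span (X '' s : Set CoordRing)) :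
    q ∈ Ideal.span (X '' s : Set CoordRing) := by
  rw [mem_ideal_span_X_image] at h ⊢
  intro m hm
  obtain ⟨j, hj, hne⟩ := h (Finsupp.single i 1 + m) (by
    rw [mem_support_iff, coeff_X_mul]; exact mem_support_iff.1 hm)
  refine ⟨j, hj, ?_⟩
  have hij : i ≠ j := by rintro rfl; exact hi hj
  simpa [Finsupp.single_apply, hij] using hne

lemma not_X_dvd_X {i j : Fin 3} (h : i ≠ j) : ¬ (X i : CoordRing) ∣ X j := by
  rw [X_dvd_X]; simpa using h

/-- Depth of a complete intersection, by a Koszul computation. If `xᵢ h = aᵢ f + bᵢ g`, comparing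
two of these expressions gives a syzygy of `f`, `g`, hence a multiple of `(g, -f)`. Adjusting `(a₀,
b₀)` by such a multiple makes both entries divisible by `x₀`, which can then be cancelled. -/
lemma isSat_span_pair {f g : CoordRing} (hf0 : f ≠ 0) (hfg : IsRelPrime f g) :
    IsSat (Ideal.span {f, g}) := by
  intro h hh
  obtain ⟨a0, b0, h0⟩ := Ideal.mem_span_pair.1 (hh 0)
  obtain ⟨a1, b1, h1⟩ := Ideal.mem_span_pair.1 (hh 1)
  obtain ⟨a2, b2, h2⟩ := Ideal.mem_span_pair.1 (hh 2)
  have hg0 : g ≠ 0 ∨ IsUnit f := by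
    by_cases hg : g = 0
    · right; rw [hg] at hfg; exact (isRelPrime_zero_right.1 hfg)
    · exact Or.inl hg
  rcases hg0 with hg0 | hu
  swap
  · exact Ideal.mem_span_pair.2 ⟨h * (hu.unit⁻¹ : CoordRingˣ), 0, by
      rw [zero_mul, add_zero, mul_assoc, IsUnit.val_inv_mul hu, mul_one]⟩
  obtain ⟨q01, h01, k01⟩ := exists_syzygy (p := X 1 * a0 - X 0 * a1) (q := X 1 * b0 - X 0 * b1)
    hf0 hfg (by linear_combination X 1 * h0 - X 0 * h1)
  obtain ⟨q02, h02, -⟩ := exists_syzygy (p := X 2 * a0 - X 0 * a2) (q := X 2 * b0 - X 0 * b2)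
    hf0 hfg (by linear_combination X 2 * h0 - X 0 * h2)
  obtain ⟨q12, h12, -⟩ := exists_syzygy (p := X 2 * a1 - X 1 * a2) (q := X 2 * b1 - X 1 * b2)
    hf0 hfg (by linear_combination X 2 * h1 - X 1 * h2)
  -- The three multipliers satisfy a linear relation. As `x₂` is a nonzerodivisor modulo `(x₀, x₁)`,
  -- it puts `q01` into `(x₀, x₁)`.
  have hrel : X 2 * q01 = X 1 * q02 - X 0 * q12 := mul_right_cancel₀ hg0 (by
    linear_combination -X 2 * h01 + X 1 * h02 - X 0 * h12)
  have hmem : q01 ∈ Ideal.span (X '' {0, 1} : Set CoordRing) := by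
    apply mem_span_X_of_mul (i := 2) (by simp)
    rw [hrel, Set.image_pair, Ideal.mem_span_pair]
    exact ⟨-q12, q02, by ring⟩
  rw [Set.image_pair, Ideal.mem_span_pair] at hmem
  obtain ⟨u, v, huv⟩ := hmem
  have hd : ∀ p q : CoordRing, X 1 * p = X 0 * q → (X 0 : CoordRing) ∣ p := fun _ q hpq =>
    ((X_prime : Prime (X 0 : CoordRing)).dvd_or_dvd ⟨q, hpq⟩).resolve_left (not_X_dvd_X (by decide))
  obtain ⟨a', ha'⟩ := hd (a0 - v * g) (a1 + u * g) (by
    linear_combination h01 - huv * g)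
  obtain ⟨b', hb'⟩ := hd (b0 + v * f) (b1 - u * f) (by
    linear_combination k01 + huv * f)
  refine Ideal.mem_span_pair.2 ⟨a', b', mul_left_cancel₀ (X_ne_zero (0 : Fin 3)) ?_⟩
  linear_combination h0 - ha' * f - hb' * g

lemma IsSat.mem_of_forall_forms {I : Ideal CoordRing} (hI : IsSat I) (k : ℕ) {p : CoordRing}
    (h : ∀ q : CoordRing, q.IsHomogeneous k → p * q ∈ I) : p ∈ I := by
  induction k generalizing p with
  | zero => simpa using h 1 (isHomogeneous_one _ _)
  | succ k ih =>
    refine hI p fun i => ih fun q hq => ?_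
    have := h (X i * q) (by rw [add_comm]; exact (isHomogeneous_X _ i).mul hq)
    convert this using 1; ring

/-! ### Growth of the Hilbert function of a saturated ideal -/

/-- A linear form that is a nonzerodivisor modulo two given saturated ideals. -/
lemma exists_linear_nzd {I J : Ideal CoordRing} (hI : IsSat I) (hJ : IsSat J) :
    ∃ l : CoordRing, l.IsHomogeneous 1 ∧ (∀ p, l * p ∈ I → p ∈ I) ∧ (∀ p, l * p ∈ J → p ∈ J) := by
  classical
  set A := associatedPrimes CoordRing (CoordRing ⧸ I) ∪ associatedPrimes CoordRing (CoordRing ⧸ J)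
  have hA : A.Finite := (associatedPrimes.finite _ _).union (associatedPrimes.finite _ _)
  -- An associated prime containing all linear forms would annihilate a nonzero class that every
  -- variable kills, against saturation. So each associated prime cuts out a proper subspace of the
  -- linear forms, and finitely many of these do not cover.
  have aux : ∀ K : Ideal CoordRing, IsSat K →
      ∀ P ∈ associatedPrimes CoordRing (CoordRing ⧸ K), formsIn P 1 ≠ ⊤ := by
    intro K hK P hP htop
    rw [AssociatedPrimes.mem_iff, isAssociatedPrime_iff] at hP
    obtain ⟨hprime, x, hx⟩ := hP
    obtain ⟨y, rfl⟩ := Ideal.Quotient.mk_surjective x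
    have hy : y ∈ K := hK y fun i => by
      have : (⟨X i, isHomogeneous_X _ i⟩ : Forms 1) ∈ formsIn P 1 := htop ▸ trivial
      rw [mem_formsIn, hx, Submodule.mem_colon_singleton] at this
      rwa [Submodule.mem_bot, ← Ideal.Quotient.mk_eq_mk, ← Submodule.Quotient.mk_smul,
        Submodule.Quotient.mk_eq_zero] at this
    apply hprime.ne_top
    rw [hx, Ideal.eq_top_iff_one, Submodule.mem_colon_singleton, one_smul,
      Ideal.Quotient.eq_zero_iff_mem.2 hy]
    exact zero_mem _
  have hne := Subspace.biUnion_ne_univ_of_top_notMem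
    (s := hA.toFinset.image fun P => formsIn P 1) (by
      simp only [Finset.mem_image, not_exists, not_and]
      intro P hP
      rcases hA.mem_toFinset.1 hP with hP | hP
      exacts [aux I hI P hP, aux J hJ P hP])
  obtain ⟨l, hl⟩ := (Set.ne_univ_iff_exists_notMem _).1 hne
  simp only [Finset.mem_image, Set.mem_iUnion, not_exists, SetLike.mem_coe] at hl
  have hnot : ∀ P ∈ A, (l : CoordRing) ∉ P := fun P hP h =>
    hl (formsIn P 1) ⟨P, hA.mem_toFinset.2 hP, rfl⟩ h
  have fin : ∀ K : Ideal CoordRing, associatedPrimes CoordRing (CoordRing ⧸ K) ⊆ A →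
      ∀ p, (l : CoordRing) * p ∈ K → p ∈ K := by
    intro K hK p hp
    by_contra hpK
    have : (l : CoordRing) ∈ {r : CoordRing | ∃ x : CoordRing ⧸ K, x ≠ 0 ∧ r • x = 0} :=
      ⟨Ideal.Quotient.mk K p, by rwa [Ne, Ideal.Quotient.eq_zero_iff_mem], by
        rw [← Ideal.Quotient.mk_eq_mk, ← Submodule.Quotient.mk_smul,
          Submodule.Quotient.mk_eq_zero]; exact hp⟩
    rw [← biUnion_associatedPrimes_eq_zero_divisors] at this
    obtain ⟨P, hP, hlP⟩ := Set.mem_iUnion₂.1 this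
    exact hnot P (hK hP) hlP
  exact ⟨l, l.2, fin I Set.subset_union_left, fin J Set.subset_union_right⟩

lemma finrank_map_add_finrank_inf_ker {V W : Type*} [AddCommGroup V] [Module ℂ V]
    [AddCommGroup W] [Module ℂ W] (φ : V →ₗ[ℂ] W) (p : Submodule ℂ V) [FiniteDimensional ℂ p] :
    Module.finrank ℂ (p.map φ) + Module.finrank ℂ (p ⊓ LinearMap.ker φ : Submodule ℂ V) =
      Module.finrank ℂ p := by
  rw [← LinearMap.finrank_range_add_finrank_ker (φ.domRestrict p), LinearMap.range_domRestrict,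
    LinearMap.ker_domRestrict, ← Submodule.finrank_map_subtype_eq p, Submodule.map_comap_subtype]

/-- Multiplication by a linear form on the graded quotient `S / I`. -/
def mulQuot {I : Ideal CoordRing} {l : CoordRing} (hl : l.IsHomogeneous 1) (t : ℕ) :
    (Forms t ⧸ formsIn I t) →ₗ[ℂ] (Forms (t + 1) ⧸ formsIn I (t + 1)) :=
  Submodule.mapQ _ _ (mulForm (add_comm 1 t) ⟨l, hl⟩) fun _ hp => I.mul_mem_left l hp

lemma mulQuot_mk {I : Ideal CoordRing} {l : CoordRing} (hl : l.IsHomogeneous 1) {t : ℕ}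
    (p : Forms t) : mulQuot (I := I) hl t (Submodule.Quotient.mk p) =
      Submodule.Quotient.mk (mulForm (add_comm 1 t) ⟨l, hl⟩ p) := rfl

lemma mulQuot_injective {I : Ideal CoordRing} {l : CoordRing} (hl : l.IsHomogeneous 1)
    (hnz : ∀ p, l * p ∈ I → p ∈ I) (t : ℕ) : Function.Injective (mulQuot (I := I) hl t) := by
  rw [injective_iff_map_eq_zero]
  intro x hx
  obtain ⟨p, rfl⟩ := Submodule.Quotient.mk_surjective _ x
  rw [mulQuot_mk, Submodule.Quotient.mk_eq_zero] at hx
  rw [Submodule.Quotient.mk_eq_zero]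
  exact hnz _ hx

lemma hilb_le_succ_of_nzd {I : Ideal CoordRing} {l : CoordRing} (hl : l.IsHomogeneous 1)
    (hnz : ∀ p, l * p ∈ I → p ∈ I) (t : ℕ) : hilb I t ≤ hilb I (t + 1) :=
  LinearMap.finrank_le_finrank_of_injective (mulQuot_injective hl hnz t)

/-- Multiplication by `l` on `S/I` is injective; between spaces of equal dimension it is also
surjective. -/
lemma exists_add_mul_of_hilb_eq {I : Ideal CoordRing} {l : CoordRing} (hl : l.IsHomogeneous 1)
    (hnz : ∀ p, l * p ∈ I → p ∈ I) {t : ℕ} (ht : hilb I t = hilb I (t + 1)) {p : CoordRing}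
    (hp : p.IsHomogeneous (t + 1)) :
    ∃ i w : CoordRing, i ∈ I ∧ i.IsHomogeneous (t + 1) ∧ w.IsHomogeneous t ∧ p = i + l * w := by
  have hs := (LinearMap.injective_iff_surjective_of_finrank_eq_finrank ht).1
    (mulQuot_injective (I := I) hl hnz t)
  obtain ⟨x, hx⟩ := hs (Submodule.Quotient.mk ⟨p, hp⟩)
  obtain ⟨w, rfl⟩ := Submodule.Quotient.mk_surjective _ x
  rw [mulQuot_mk, eq_comm, Submodule.Quotient.eq] at hx
  have hlw : (l * w.1).IsHomogeneous (t + 1) := by rw [add_comm]; exact hl.mul w.2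
  exact ⟨p - l * w, w, hx, hp.sub hlw, w.2, by ring⟩

lemma hilb_le_succ {I : Ideal CoordRing} (hI : IsSat I) (t : ℕ) : hilb I t ≤ hilb I (t + 1) := by
  obtain ⟨l, hl, hnz, -⟩ := exists_linear_nzd hI hI
  exact hilb_le_succ_of_nzd hl hnz t

lemma hilb_mono {I : Ideal CoordRing} (hI : IsSat I) : Monotone (hilb I) :=
  monotone_nat_of_le_succ (hilb_le_succ hI)

/-- A form of positive degree is a combination of the variables. -/
lemma exists_sum_X_mul {t : ℕ} {p : CoordRing} (hp : p.IsHomogeneous (t + 1)) :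
    ∃ q : Fin 3 → CoordRing, (∀ i, (q i).IsHomogeneous t) ∧ p = ∑ i, X i * q i := by
  have hmem : p ∈ Ideal.span (Set.range (X : Fin 3 → CoordRing)) := by
    rw [← Set.image_univ, mem_ideal_span_X_image]
    intro m hm
    by_contra! h
    have h0 : m = 0 := Finsupp.ext fun i => h i (Set.mem_univ i)
    have h1 := IsHomogeneous.coeff_eq_zero hp (d := m) (by rw [h0]; simp)
    exact mem_support_iff.1 hm h1
  obtain ⟨q, hq⟩ := (Ideal.mem_span_range_iff_exists_fun).1 hmem
  refine ⟨fun i => homogeneousComponent t (q i), fun i => homogeneousComponent_isHomogeneous _ _, ?_⟩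
  rw [← homogeneousComponent_eq_self hp, ← hq, map_sum]
  refine Finset.sum_congr rfl fun i _ => ?_
  rw [mul_comm, add_comm, homogeneousComponent_mul_add (isHomogeneous_X _ i)]

/-- Once the Hilbert function repeats a value, the ideal is generated by its forms of the next
degree. -/
lemma mem_span_of_hilb_eq {I : Ideal CoordRing} (hI : IsSat I) {t : ℕ}
    (ht : hilb I t = hilb I (t + 1)) {p : CoordRing} (hp : p.IsHomogeneous (t + 2)) (hpI : p ∈ I) :
    ∃ q : Fin 3 → CoordRing, (∀ i, (q i).IsHomogeneous (t + 1) ∧ q i ∈ I) ∧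
      ∃ w ∈ I, w.IsHomogeneous (t + 1) ∧ ∃ l : CoordRing, l.IsHomogeneous 1 ∧
      p = ∑ i, X i * q i + l * w := by
  obtain ⟨l, hl, hnz, -⟩ := exists_linear_nzd hI hI
  obtain ⟨q, hq, rfl⟩ := exists_sum_X_mul hp
  choose a b ha ha' hb hab using fun i => exists_add_mul_of_hilb_eq hl hnz ht (hq i)
  have heq : ∑ i, X i * q i = ∑ i, X i * a i + l * ∑ i, X i * b i := by
    rw [Finset.mul_sum, ← Finset.sum_add_distrib]
    refine Finset.sum_congr rfl fun i _ => ?_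
    rw [hab i]; ring
  refine ⟨a, fun i => ⟨ha' i, ha i⟩, ∑ i, X i * b i, ?_, ?_, l, hl, heq⟩
  · apply hnz
    have : l * ∑ i, X i * b i = ∑ i, X i * q i - ∑ i, X i * a i := by rw [heq]; ring
    rw [this]
    exact sub_mem hpI (Submodule.sum_mem _ fun i _ => I.mul_mem_left _ (ha i))
  · refine IsHomogeneous.sum _ _ _ fun i _ => ?_
    rw [add_comm]
    exact (isHomogeneous_X _ i).mul (hb i)

/-- Surjectivity of multiplication by `l` passes to the next degree, since forms of positive degree
are combinations of the variables. -/
lemma hilb_succ_eq_of_hilb_eq {I : Ideal CoordRing} (hI : IsSat I) {t : ℕ}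
    (ht : hilb I t = hilb I (t + 1)) : hilb I (t + 1) = hilb I (t + 2) := by
  obtain ⟨l, hl, hnz, -⟩ := exists_linear_nzd hI hI
  refine le_antisymm (hilb_le_succ hI _) ?_
  refine LinearMap.finrank_le_finrank_of_surjective (f := mulQuot (I := I) hl (t + 1)) ?_
  intro x
  obtain ⟨p, rfl⟩ := Submodule.Quotient.mk_surjective _ x
  obtain ⟨q, hq, hpq⟩ := exists_sum_X_mul p.2
  choose a b ha ha' hb hab using fun i => exists_add_mul_of_hilb_eq hl hnz ht (hq i)
  have hw : (∑ i, X i * b i).IsHomogeneous (t + 1) := IsHomogeneous.sum _ _ _ fun i _ => by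
    rw [add_comm]; exact (isHomogeneous_X _ i).mul (hb i)
  refine ⟨Submodule.Quotient.mk ⟨_, hw⟩, ?_⟩
  rw [mulQuot_mk, eq_comm, Submodule.Quotient.eq, mem_formsIn]
  have : ((p - mulForm (add_comm 1 (t + 1)) ⟨l, hl⟩ ⟨_, hw⟩ : Forms (t + 1 + 1)) : CoordRing) =
      ∑ i, X i * a i := by
    change (p : CoordRing) - l * ∑ i, X i * b i = _
    rw [hpq, Finset.mul_sum, ← Finset.sum_sub_distrib]
    refine Finset.sum_congr rfl fun i _ => ?_
    rw [hab i]; ring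
  rw [this]
  exact Submodule.sum_mem _ fun i _ => I.mul_mem_left _ (ha i)

lemma hilb_eq_of_le {I : Ideal CoordRing} (hI : IsSat I) {t : ℕ}
    (ht : hilb I t = hilb I (t + 1)) {s : ℕ} (hs : t ≤ s) : hilb I s = hilb I t := by
  have : ∀ k, hilb I (t + k) = hilb I (t + k + 1) := by
    intro k
    induction k with
    | zero => exact ht
    | succ k ih => exact hilb_succ_eq_of_hilb_eq hI ih
  obtain ⟨k, rfl⟩ := Nat.exists_eq_add_of_le hs
  clear hs
  induction k with
  | zero => rfl
  | succ k ih => rw [← ih, this k]; rfl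

/-- Dehomogenizing with respect to a nonzerodivisor `l` loses nothing on forms. Write `h = i + (l -
1) v` and compare degrees: modulo `I`, the components of `v` vanish below degree `t` and equal `-lᵏ
h` in degree `t + k`. Since `v` has finitely many components, some `lᵏ h` lies in `I`. -/
lemma mem_of_mem_sup_span_sub_one {I : Ideal CoordRing} (hI : IsHomog I) {l : CoordRing}
    (hl : l.IsHomogeneous 1) (hnz : ∀ p, l * p ∈ I → p ∈ I) {h : CoordRing} {t : ℕ}
    (hh : h.IsHomogeneous t) (hmem : h ∈ I ⊔ Ideal.span {l - 1}) : h ∈ I := by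
  obtain ⟨i, hi, j, hj, hij⟩ := Submodule.mem_sup.1 hmem
  obtain ⟨v, rfl⟩ := Ideal.mem_span_singleton.1 hj
  have hc : ∀ k, homogeneousComponent k h = homogeneousComponent k i +
      homogeneousComponent k (l * v) - homogeneousComponent k v := by
    intro k; rw [← hij, sub_mul, one_mul, map_add, map_sub]; ring
  have hsucc : ∀ k, homogeneousComponent (k + 1) (l * v) = l * homogeneousComponent k v := by
    intro k; rw [add_comm, homogeneousComponent_mul_add hl]
  have hzero : homogeneousComponent 0 (l * v) = 0 := by
    rw [homogeneousComponent_mul hl]; simp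
  have hlow : ∀ k, k < t → homogeneousComponent k v ∈ I := by
    intro k hk
    have h0 := hc k
    rw [homogeneousComponent_of_mem hh, if_neg hk.ne] at h0
    induction k with
    | zero =>
      rw [hzero] at h0
      have : homogeneousComponent 0 v = homogeneousComponent 0 i := by linear_combination h0
      rw [this]; exact hI i hi 0
    | succ k ih =>
      rw [hsucc] at h0
      have h1 := hc k
      rw [homogeneousComponent_of_mem hh, if_neg (by omega)] at h1
      have : homogeneousComponent (k + 1) v =
        homogeneousComponent (k + 1) i + l * homogeneousComponent k v := by linear_combination h0
      rw [this]
      exact add_mem (hI i hi _) (I.mul_mem_left _ (ih (by omega) h1))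
  have hup : ∀ k, homogeneousComponent (t + k) v + l ^ k * h ∈ I := by
    intro k
    induction k with
    | zero =>
      have h0 := hc t
      rw [homogeneousComponent_eq_self hh] at h0
      cases t with
      | zero =>
        rw [hzero] at h0
        have : homogeneousComponent (0 + 0) v + l ^ 0 * h = homogeneousComponent 0 i := by
          rw [pow_zero]; linear_combination h0
        rw [this]; exact hI i hi 0
      | succ t =>
        rw [hsucc] at h0
        have : homogeneousComponent (t + 1 + 0) v + l ^ 0 * h =
          homogeneousComponent (t + 1) i + l * homogeneousComponent t v := by
          rw [pow_zero, add_zero]; linear_combination h0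
        rw [this]
        exact add_mem (hI i hi _) (I.mul_mem_left _ (hlow t (by omega)))
    | succ k ih =>
      have h0 := hc (t + k + 1)
      rw [homogeneousComponent_of_mem hh, if_neg (by omega), hsucc] at h0
      have : homogeneousComponent (t + (k + 1)) v + l ^ (k + 1) * h =
          homogeneousComponent (t + k + 1) i + l * (homogeneousComponent (t + k) v + l ^ k * h) := by
        rw [← add_assoc, pow_succ]; linear_combination h0
      rw [this]
      exact add_mem (hI i hi _) (I.mul_mem_left _ ih)
  have hpow : ∀ k, l ^ k * h ∈ I → h ∈ I := by
    intro k
    induction k with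
    | zero => simp
    | succ k ih => intro hk; exact ih (hnz _ (by rwa [← mul_assoc, ← pow_succ']))
  have := hup (v.totalDegree + 1)
  rw [homogeneousComponent_eq_zero _ _ (by omega), zero_add] at this
  exact hpow _ this

/-! ### Complete intersections: Hilbert function and socle -/

/-- The data of a complete intersection of two plane curves of degrees `a` and `b`, with
`a + b = m + 3`, and of a line that misses it. -/
structure IsCI (f g l : CoordRing) (a b m : ℕ) : Prop where
  hf : f.IsHomogeneous a
  hg : g.IsHomogeneous b
  f0 : f ≠ 0
  g0 : g ≠ 0
  rel : IsRelPrime f g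
  hl : l.IsHomogeneous 1
  nzd : ∀ p, l * p ∈ Ideal.span {f, g} → p ∈ Ideal.span {f, g}
  a0 : 0 < a
  b0 : 0 < b
  deg : a + b = m + 3

section CI

variable {f g l : CoordRing} {a b m : ℕ}

lemma IsCI.l0 (h : IsCI f g l a b m) : l ≠ 0 := by
  intro h0
  have h1 : (1 : CoordRing) ∈ Ideal.span {f, g} := h.nzd 1 (by rw [h0, zero_mul]; exact zero_mem _)
  have h2 := finrank_formsIn_span_pair h.hf h.hg h.f0 h.g0 h.rel 0
  have ha := h.a0
  have hb := h.b0
  rw [Nat.sub_eq_zero_of_le (by omega), Nat.sub_eq_zero_of_le (by omega),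
    Nat.sub_eq_zero_of_le (by omega), tri_zero, add_zero, add_zero, Submodule.finrank_eq_zero] at h2
  have h3 : (⟨1, isHomogeneous_one _ _⟩ : Forms 0) ∈ formsIn (Ideal.span {f, g}) 0 := h1
  rw [h2, Submodule.mem_bot] at h3
  exact one_ne_zero (congrArg Subtype.val h3)

lemma IsCI.hilb_of_lt (h : IsCI f g l a b m) {t : ℕ} (ht : m < t) :
    hilb (Ideal.span {f, g}) t = a * b := by
  have h1 := finrank_formsIn_span_pair h.hf h.hg h.f0 h.g0 h.rel t
  have h2 := hilb_add_finrank (Ideal.span {f, g}) t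
  obtain ⟨a, rfl⟩ := Nat.exists_eq_add_of_lt h.a0
  obtain ⟨b, rfl⟩ := Nat.exists_eq_add_of_lt h.b0
  have hd := h.deg
  obtain ⟨j, hj⟩ : ∃ j, t + 1 = a + b + 1 + j := ⟨t - (a + b), by omega⟩
  rw [hj] at h1 h2
  have e1 : a + b + 1 + j - (0 + a + 1) = b + j := by omega
  have e2 : a + b + 1 + j - (0 + b + 1) = a + j := by omega
  rw [e1, e2] at h1
  have t1 := two_mul_tri (b + j)
  have t2 := two_mul_tri (a + j)
  have t3 := two_mul_tri (a + b + 1 + j)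
  cases j with
  | zero =>
    rw [Nat.sub_eq_zero_of_le (by omega), tri_zero] at h1
    nlinarith
  | succ j =>
    have e3 : a + b + 1 + (j + 1) - (0 + a + 1 + (0 + b + 1)) = j := by omega
    have t4 := two_mul_tri j
    rw [e3] at h1
    nlinarith

/-- The Hilbert function is one short of the Bézout number `ab` exactly at the last degree before it
becomes constant. This single missing dimension supplies the functional behind the duality. -/
lemma IsCI.hilb_self (h : IsCI f g l a b m) : hilb (Ideal.span {f, g}) m + 1 = a * b := by
  have h1 := finrank_formsIn_span_pair h.hf h.hg h.f0 h.g0 h.rel m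
  have h2 := hilb_add_finrank (Ideal.span {f, g}) m
  obtain ⟨a, rfl⟩ := Nat.exists_eq_add_of_lt h.a0
  obtain ⟨b, rfl⟩ := Nat.exists_eq_add_of_lt h.b0
  have hd := h.deg
  have hm : m + 1 = a + b := by omega
  rw [hm] at h1 h2
  have e1 : a + b - (0 + a + 1) = b - 1 := by omega
  have e2 : a + b - (0 + b + 1) = a - 1 := by omega
  rw [e1, e2, Nat.sub_eq_zero_of_le (by omega), tri_zero] at h1
  have key : ∀ n : ℕ, 2 * tri (n - 1) + n = n * n := by
    intro n
    cases n with
    | zero => rfl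
    | succ n => have := two_mul_tri n; rw [Nat.add_sub_cancel]; nlinarith
  have t1 := key a
  have t2 := key b
  have t3 := two_mul_tri (a + b)
  nlinarith

/-- Modulo `l` the only syzygies of `f`, `g` are still the Koszul ones, because `l` is a
nonzerodivisor modulo `(f, g)`. -/
lemma IsCI.mem_sup_of_mul_add_mul_mem (h : IsCI f g l a b m) {p q : CoordRing}
    (hpq : p * f + q * g ∈ Ideal.span {l}) :
    ∃ k u v, p = k * g + l * u ∧ q = -(k * f) + l * v := by
  obtain ⟨w, hw⟩ := Ideal.mem_span_singleton.1 hpq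
  have hmem : w ∈ Ideal.span {f, g} := h.nzd w (by rw [← hw]; exact Ideal.mem_span_pair.2 ⟨p, q, rfl⟩)
  obtain ⟨u, v, huv⟩ := Ideal.mem_span_pair.1 hmem
  obtain ⟨k, h1, h2⟩ := exists_syzygy (p := p - l * u) (q := q - l * v) h.f0 h.rel
    (by linear_combination hw - l * huv)
  exact ⟨k, u, v, by linear_combination h1, by linear_combination h2⟩

/-- In degree `c` the product `k r` contributes nothing, as `r` has larger degree. -/
lemma dvd_of_eq_mul_add {c : ℕ} {p k r l u : CoordRing} {d : ℕ} (hl : l.IsHomogeneous 1)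
    (hr : r.IsHomogeneous d) (hp : p.IsHomogeneous c) (hcd : c < d) (h : p = k * r + l * u) :
    l ∣ p := by
  have h1 := congrArg (homogeneousComponent c) h
  rw [homogeneousComponent_eq_self hp, map_add, mul_comm k, homogeneousComponent_mul hr,
    if_neg (by omega), zero_add, homogeneousComponent_mul hl] at h1
  split_ifs at h1 with h2
  · exact ⟨_, h1⟩
  · rw [h1]; exact dvd_zero _

lemma exists_mul_X_eq_sum {l : CoordRing} (hl : l.IsHomogeneous 1) (hl0 : l ≠ 0) :
    ∃ (c : Fin 3 → ℂ) (k : Fin 3), c k ≠ 0 ∧ l = ∑ i, C (c i) * X i := by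
  have h1 : l ∈ homogeneousSubmodule (Fin 3) ℂ 1 := hl
  rw [homogeneousSubmodule_one_eq_span_X, Submodule.mem_span_range_iff_exists_fun] at h1
  obtain ⟨c, hc⟩ := h1
  by_contra! hcon
  have hc' : l = ∑ i, C (c i) * X i := by rw [← hc]; simp only [smul_eq_C_mul]
  apply hl0
  rw [hc']
  refine Finset.sum_eq_zero fun i _ => ?_
  rw [show c i = 0 by by_contra h; exact hcon c i h hc', C_0, zero_mul]

/-- If `x_k` occurs in `l`, the other two variables together with `l` are linear coordinates. -/
lemma exists_coordinates {l : CoordRing} (hl : l.IsHomogeneous 1) (hl0 : l ≠ 0) :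
    ∃ i j : Fin 3, i ≠ j ∧ ¬ (X i : CoordRing) ∣ l ∧
      ∀ q, l * q ∈ Ideal.span {(X i : CoordRing), X j} → q ∈ Ideal.span {(X i : CoordRing), X j} := by
  obtain ⟨c, k, hck, hc⟩ := exists_mul_X_eq_sum hl hl0
  obtain ⟨i, j, hij, hik, hjk, hall⟩ : ∃ i j : Fin 3, i ≠ j ∧ i ≠ k ∧ j ≠ k ∧
      ∀ x, x = i ∨ x = j ∨ x = k := by
    fin_cases k
    exacts [⟨1, 2, by decide⟩, ⟨0, 2, by decide⟩, ⟨0, 1, by decide⟩]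
  have hkey : ∀ q, l * q ∈ Ideal.span {(X i : CoordRing), X j} →
      q ∈ Ideal.span {(X i : CoordRing), X j} := by
    intro q hq
    rw [← Set.image_pair] at hq ⊢
    have hrest : ∑ x ∈ Finset.univ.erase k, C (c x) * X x ∈
        Ideal.span (X '' {i, j} : Set CoordRing) := by
      refine Submodule.sum_mem _ fun x hx => Ideal.mul_mem_left _ _ (Ideal.subset_span ⟨x, ?_, rfl⟩)
      rcases hall x with h | h | h
      · exact Or.inl h
      · exact Or.inr h
      · exact absurd h (Finset.ne_of_mem_erase hx)
    have h1 : X k * (C (c k) * q) ∈ Ideal.span (X '' {i, j} : Set CoordRing) := by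
      have : X k * (C (c k) * q) = l * q - (∑ x ∈ Finset.univ.erase k, C (c x) * X x) * q := by
        rw [hc, ← Finset.add_sum_erase _ _ (Finset.mem_univ k)]; ring
      rw [this]
      exact sub_mem hq (Ideal.mul_mem_right _ _ hrest)
    have h2 := mem_span_X_of_mul (by simp [hik.symm, hjk.symm]) h1
    have h3 : q = C (c k)⁻¹ * (C (c k) * q) := by
      rw [← mul_assoc, ← C_mul, inv_mul_cancel₀ hck, C_1, one_mul]
    rw [h3]
    exact Ideal.mul_mem_left _ _ h2
  refine ⟨i, j, hij, ?_, hkey⟩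
  rintro ⟨q, hq⟩
  have h1 := hkey 1 (by rw [hq, mul_one, mul_comm]; exact Ideal.mul_mem_left _ _ (Ideal.subset_span (by simp)))
  rw [← Set.image_pair, mem_ideal_span_X_image] at h1
  obtain ⟨x, -, hx⟩ := h1 0 (by simp)
  exact hx rfl

lemma exists_homogeneous_combination {f g l : CoordRing} {a b t : ℕ} (hf : f.IsHomogeneous a)
    (hg : g.IsHomogeneous b) {h : CoordRing} (hh : h.IsHomogeneous t)
    (hmem : h ∈ Ideal.span {f, g} ⊔ Ideal.span {l}) (hl : l.IsHomogeneous 1) :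
    ∃ A B E : CoordRing, h = A * f + B * g + l * E ∧ (∀ c, t = a + c → A.IsHomogeneous c) ∧
      (t < a → A = 0) ∧ (∀ c, t = b + c → B.IsHomogeneous c) ∧ (t < b → B = 0) := by
  obtain ⟨x, hx, y, hy, hxy⟩ := Submodule.mem_sup.1 hmem
  obtain ⟨A, B, rfl⟩ := Ideal.mem_span_pair.1 hx
  obtain ⟨E, rfl⟩ := Ideal.mem_span_singleton.1 hy
  have h1 := congrArg (homogeneousComponent t) hxy
  rw [homogeneousComponent_eq_self hh, map_add, map_add, mul_comm A, mul_comm B,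
    homogeneousComponent_mul hf, homogeneousComponent_mul hg, homogeneousComponent_mul hl] at h1
  refine ⟨if a ≤ t then homogeneousComponent (t - a) A else 0,
    if b ≤ t then homogeneousComponent (t - b) B else 0,
    if 1 ≤ t then homogeneousComponent (t - 1) E else 0, ?_, ?_, ?_, ?_, ?_⟩
  · rw [← h1]
    split_ifs <;> ring
  · rintro c rfl
    simp only [le_add_iff_nonneg_right, zero_le, if_true, Nat.add_sub_cancel_left]
    exact homogeneousComponent_isHomogeneous _ _
  · intro h; rw [if_neg (by omega)]
  · rintro c rfl
    simp only [le_add_iff_nonneg_right, zero_le, if_true, Nat.add_sub_cancel_left]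
    exact homogeneousComponent_isHomogeneous _ _
  · intro h; rw [if_neg (by omega)]

/-- The socle of `S / (f, g, l)` lives in degree `m + 1`. -/
lemma IsCI.socle (h : IsCI f g l a b m) {p : CoordRing} {u : ℕ} (hp : p.IsHomogeneous u)
    (hu : u ≤ m) (hX : ∀ i : Fin 3, X i * p ∈ Ideal.span {f, g} ⊔ Ideal.span {l}) :
    p ∈ Ideal.span {f, g} ⊔ Ideal.span {l} := by
  obtain ⟨i, j, hij, hdvd, hnz⟩ := exists_coordinates h.hl h.l0
  have hdeg := h.deg
  have hXp : ∀ i : Fin 3, (X i * p).IsHomogeneous (1 + u) := fun i => (isHomogeneous_X _ i).mul hp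
  obtain ⟨A, B, E, hABE, hA, hA0, hB, hB0⟩ :=
    exists_homogeneous_combination h.hf h.hg (hXp i) (hX i) h.hl
  obtain ⟨A', B', E', hABE', hA', hA0', hB', hB0'⟩ :=
    exists_homogeneous_combination h.hf h.hg (hXp j) (hX j) h.hl
  -- Eliminating `p` between the expressions for `xᵢ p` and `xⱼ p` gives a syzygy of `f`, `g` modulo
  -- `l`.
  obtain ⟨k, x, y, hx, hy⟩ := h.mem_sup_of_mul_add_mul_mem (p := X j * A - X i * A')
    (q := X j * B - X i * B') (Ideal.mem_span_singleton.2 ⟨X i * E' - X j * E, by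
      linear_combination X i * hABE' - X j * hABE⟩)
  -- The entry has degree `u + 2 - a`, which is less than `b` because `u ≤ a + b - 3`. The Koszul
  -- multiple of `g` therefore cannot appear; for the other entry exchange `a` and `b`.
  have hd1 : l ∣ X j * A - X i * A' := by
    rcases lt_or_ge (1 + u) a with hlt | hge
    · rw [hA0 hlt, hA0' hlt]; simp
    · obtain ⟨c, hc⟩ := Nat.exists_eq_add_of_le hge
      exact dvd_of_eq_mul_add h.hl h.hg (((isHomogeneous_X _ j).mul (hA c hc)).sub
        ((isHomogeneous_X _ i).mul (hA' c hc))) (by omega) hx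
  have hd2 : l ∣ X j * B - X i * B' := by
    rcases lt_or_ge (1 + u) b with hlt | hge
    · rw [hB0 hlt, hB0' hlt]; simp
    · obtain ⟨c, hc⟩ := Nat.exists_eq_add_of_le hge
      exact dvd_of_eq_mul_add (k := -k) (u := y) h.hl h.hf (((isHomogeneous_X _ j).mul (hB c hc)).sub
        ((isHomogeneous_X _ i).mul (hB' c hc))) (by omega) (by rw [hy]; ring)
  -- Since `xᵢ`, `xⱼ`, `l` form a regular sequence, such a relation puts `P` into `(xᵢ, l)`. Applied
  -- to `A` and `B`, this allows `xᵢ` to be cancelled from the expression for `xᵢ p`.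
  have aux : ∀ P Q : CoordRing, l ∣ X j * P - X i * Q → ∃ P' v, P = X i * P' + l * v := by
    rintro P Q ⟨w, hw⟩
    obtain ⟨s, v, hsv⟩ := Ideal.mem_span_pair.1 (hnz w (by
      rw [← hw]; exact Ideal.mem_span_pair.2 ⟨-Q, P, by ring⟩))
    have hd : (X i : CoordRing) ∣ X j * (P - l * v) :=
      ⟨Q + l * s, by linear_combination hw - l * hsv⟩
    obtain ⟨P', hP'⟩ := ((X_prime : Prime (X i : CoordRing)).dvd_or_dvd hd).resolve_left
      (not_X_dvd_X hij)
    exact ⟨P', v, by linear_combination hP'⟩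
  obtain ⟨A₁, v, hv⟩ := aux A A' hd1
  obtain ⟨B₁, w, hw⟩ := aux B B' hd2
  have hd : (X i : CoordRing) ∣ l * (E + v * f + w * g) :=
    ⟨p - A₁ * f - B₁ * g, by linear_combination -hABE - hv * f - hw * g⟩
  obtain ⟨z, hz⟩ := ((X_prime : Prime (X i : CoordRing)).dvd_or_dvd hd).resolve_left hdvd
  have hfin : p = A₁ * f + B₁ * g + l * z := mul_left_cancel₀ (X_ne_zero i) (by
    linear_combination hABE + hv * f + hw * g + l * hz)
  rw [hfin]
  exact Submodule.add_mem_sup (Ideal.mem_span_pair.2 ⟨_, _, rfl⟩)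
    (Ideal.mem_span_singleton.2 (dvd_mul_right _ _))

lemma IsCI.exists_mul_notMem (h : IsCI f g l a b m) (k : ℕ) : ∀ {p : CoordRing} {u : ℕ},
    p.IsHomogeneous u → u + k = m + 1 → p ∉ Ideal.span {f, g} ⊔ Ideal.span {l} →
    ∃ c : CoordRing, c.IsHomogeneous k ∧ c * p ∉ Ideal.span {f, g} ⊔ Ideal.span {l} := by
  induction k with
  | zero => intro p u _ _ hmem; exact ⟨1, isHomogeneous_one _ _, by rwa [one_mul]⟩
  | succ k ih =>
    intro p u hp hu hmem
    obtain ⟨i, hi⟩ : ∃ i : Fin 3, X i * p ∉ Ideal.span {f, g} ⊔ Ideal.span {l} := by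
      by_contra! hcon
      exact hmem (h.socle hp (by omega) hcon)
    obtain ⟨c, hc, hcp⟩ := ih ((isHomogeneous_X _ i).mul hp) (by omega) hi
    exact ⟨c * X i, hc.mul (isHomogeneous_X _ i), by rwa [mul_assoc]⟩

end CI

/-! ### The filtered affine coordinate ring and its duality -/

/-- The coordinate ring of the complement of the line `l = 0` in the scheme `f = g = 0`. -/
abbrev AffRing (f g l : CoordRing) : Type :=
  CoordRing ⧸ (Ideal.span {f, g} ⊔ Ideal.span {l - 1})

/-- Dehomogenization with respect to `l`. -/
def aff (f g l : CoordRing) : CoordRing →ₐ[ℂ] AffRing f g l := Ideal.Quotient.mkₐ ℂ _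

/-- The filtration of the affine coordinate ring by degree, shifted by one. -/
def filt (f g l : CoordRing) : ℕ → Submodule ℂ (AffRing f g l)
  | 0 => ⊥
  | k + 1 => (Forms k).map (aff f g l).toLinearMap

section

variable {f g l : CoordRing} {a b m : ℕ}

lemma aff_surjective : Function.Surjective (aff f g l) := Ideal.Quotient.mk_surjective

lemma aff_eq_zero {p : CoordRing} :
    aff f g l p = 0 ↔ p ∈ Ideal.span {f, g} ⊔ Ideal.span {l - 1} := Ideal.Quotient.eq_zero_iff_mem

lemma aff_l : aff f g l l = 1 := by
  rw [← sub_eq_zero, ← map_one (aff f g l), ← map_sub, aff_eq_zero]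
  exact Submodule.mem_sup_right (Ideal.mem_span_singleton_self _)

lemma aff_mem_filt {p : CoordRing} {t : ℕ} (hp : p.IsHomogeneous t) :
    aff f g l p ∈ filt f g l (t + 1) := ⟨p, hp, rfl⟩

lemma exists_of_mem_filt_succ {x : AffRing f g l} {t : ℕ} (hx : x ∈ filt f g l (t + 1)) :
    ∃ p : CoordRing, p.IsHomogeneous t ∧ aff f g l p = x := hx

lemma aff_eq_zero_of_mem {p : CoordRing} (hp : p ∈ Ideal.span {f, g}) : aff f g l p = 0 :=
  aff_eq_zero.2 (Submodule.mem_sup_left hp)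

lemma IsCI.aff_eq_zero_iff (h : IsCI f g l a b m) {p : CoordRing} {t : ℕ}
    (hp : p.IsHomogeneous t) : aff f g l p = 0 ↔ p ∈ Ideal.span {f, g} :=
  ⟨fun h0 => mem_of_mem_sup_span_sub_one (isHomog_span_pair h.hf h.hg) h.hl h.nzd hp
    (aff_eq_zero.1 h0), aff_eq_zero_of_mem⟩

lemma IsCI.filt_mono (h : IsCI f g l a b m) : Monotone (filt f g l) := by
  refine monotone_nat_of_le_succ fun k => ?_
  cases k with
  | zero => exact bot_le
  | succ k =>
    intro x hx
    obtain ⟨p, hp, rfl⟩ := exists_of_mem_filt_succ hx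
    rw [← one_mul (aff f g l p), ← aff_l, ← map_mul]
    exact aff_mem_filt (by rw [add_comm]; exact h.hl.mul hp)

lemma mul_mem_filt {x y : AffRing f g l} {s t : ℕ} (hx : x ∈ filt f g l (s + 1))
    (hy : y ∈ filt f g l (t + 1)) : x * y ∈ filt f g l (s + t + 1) := by
  obtain ⟨p, hp, rfl⟩ := exists_of_mem_filt_succ hx
  obtain ⟨q, hq, rfl⟩ := exists_of_mem_filt_succ hy
  rw [← map_mul]
  exact aff_mem_filt (hp.mul hq)

instance (t : ℕ) : FiniteDimensional ℂ (filt f g l t) := by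
  cases t with
  | zero => exact inferInstanceAs (FiniteDimensional ℂ (⊥ : Submodule ℂ (AffRing f g l)))
  | succ t =>
    exact inferInstanceAs (FiniteDimensional ℂ ((Forms t).map (aff f g l).toLinearMap))

lemma IsCI.finrank_filt (h : IsCI f g l a b m) (t : ℕ) :
    Module.finrank ℂ (filt f g l (t + 1)) = hilb (Ideal.span {f, g}) t := by
  set φ := (aff f g l).toLinearMap ∘ₗ (Forms t).subtype with hφ
  have h1 := LinearMap.finrank_range_add_finrank_ker φ
  have hr : LinearMap.range φ = filt f g l (t + 1) := by
    rw [hφ, LinearMap.range_comp, Submodule.range_subtype]; rfl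
  have hk : LinearMap.ker φ = formsIn (Ideal.span {f, g}) t := by
    ext p
    exact h.aff_eq_zero_iff p.2
  have h2 := hilb_add_finrank (Ideal.span {f, g}) t
  rw [hr, hk, finrank_forms] at h1
  omega

lemma IsCI.filt_eq_top (h : IsCI f g l a b m) {k : ℕ} (hk : m + 1 < k) : filt f g l k = ⊤ := by
  have hstab : ∀ k, m + 1 < k → filt f g l (m + 2) = filt f g l k := by
    intro k hk
    obtain ⟨j, rfl⟩ := Nat.exists_eq_add_of_lt hk
    refine Submodule.eq_of_le_of_finrank_eq (h.filt_mono (by omega)) ?_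
    rw [h.finrank_filt, h.finrank_filt, h.hilb_of_lt (by omega), h.hilb_of_lt (by omega)]
  rw [← hstab k hk, eq_top_iff]
  intro x _
  obtain ⟨p, rfl⟩ := aff_surjective x
  rw [← sum_homogeneousComponent p, map_sum]
  refine Submodule.sum_mem _ fun i _ => ?_
  have hi : aff f g l (homogeneousComponent i p) ∈ filt f g l (i + 1) :=
    aff_mem_filt (homogeneousComponent_isHomogeneous i p)
  rcases lt_or_ge (m + 1) (i + 1) with h1 | h1
  · rwa [hstab _ h1]
  · exact h.filt_mono (by omega) hi

lemma IsCI.finiteDimensional (h : IsCI f g l a b m) : FiniteDimensional ℂ (AffRing f g l) := by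
  have : FiniteDimensional ℂ (⊤ : Submodule ℂ (AffRing f g l)) := by
    rw [← h.filt_eq_top (k := m + 2) (by omega)]; infer_instance
  exact Module.finite_def.2 ((Submodule.fg_top _).1 (Module.finite_def.1 this))

lemma IsCI.finrank_affRing (h : IsCI f g l a b m) : Module.finrank ℂ (AffRing f g l) = a * b := by
  rw [← finrank_top, ← h.filt_eq_top (k := m + 2) (by omega), h.finrank_filt,
    h.hilb_of_lt (by omega)]

/-- The step `filt f g l (m + 1)` has dimension `ab - 1`, so it is a hyperplane. -/
lemma IsCI.exists_functional (h : IsCI f g l a b m) : ∃ lam : AffRing f g l →ₗ[ℂ] ℂ,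
    ∀ x, lam x = 0 ↔ x ∈ filt f g l (m + 1) := by
  have := h.finiteDimensional
  have hfr : Module.finrank ℂ (filt f g l (m + 1)) + 1 = Module.finrank ℂ (AffRing f g l) := by
    rw [h.finrank_filt, h.hilb_self, h.finrank_affRing]
  obtain ⟨v, hv⟩ : ∃ v, v ∉ filt f g l (m + 1) := by
    by_contra! hcon
    rw [(Submodule.eq_top_iff'.2 hcon), finrank_top] at hfr
    omega
  obtain ⟨lam, hlv, hle⟩ := Submodule.exists_le_ker_of_notMem hv
  refine ⟨lam, fun x => ⟨fun hx => ?_, fun hx => hle hx⟩⟩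
  by_contra hmem
  have hlt : filt f g l (m + 1) < LinearMap.ker lam :=
    lt_of_le_of_ne hle fun heq => hmem (heq ▸ hx)
  have h1 := Submodule.finrank_lt_finrank_of_lt hlt
  have h2 : LinearMap.ker lam = ⊤ := Submodule.eq_top_of_finrank_eq
    (le_antisymm (Submodule.finrank_le _) (by omega))
  exact hlv (LinearMap.mem_ker.1 (h2 ▸ Submodule.mem_top))

/-- At the exact filtration level of `x`, its leading form is nonzero in `S/(f,g,l)`. As the socle
lies in degree `m + 1`, some form multiplies it to a nonzero element of that degree. -/
lemma IsCI.exists_mul_notMem_filt (h : IsCI f g l a b m) {x : AffRing f g l} {k : ℕ}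
    (hx : x ∉ filt f g l k) : ∃ c ∈ filt f g l (m + 2 - k), x * c ∉ filt f g l (m + 1) := by
  classical
  have hex : ∃ j, x ∈ filt f g l j :=
    ⟨m + 2, by rw [h.filt_eq_top (by omega)]; exact Submodule.mem_top⟩
  have hlt : k < Nat.find hex := by
    by_contra hcon
    exact hx (h.filt_mono (not_lt.1 hcon) (Nat.find_spec hex))
  obtain ⟨j, hj⟩ : ∃ j, Nat.find hex = j + 1 := Nat.exists_eq_succ_of_ne_zero (by omega)
  have hxj : x ∈ filt f g l (j + 1) := hj ▸ Nat.find_spec hex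
  have hxj' : x ∉ filt f g l j := Nat.find_min hex (by omega)
  have hjm : j + 1 ≤ m + 2 := by
    rw [← hj]
    exact Nat.find_min' hex (by rw [h.filt_eq_top (by omega)]; exact Submodule.mem_top)
  obtain ⟨p, hp, rfl⟩ := exists_of_mem_filt_succ hxj
  -- Otherwise `p` could be replaced by a form of degree one less, as `l` maps to `1`, and `x` would
  -- lie one step lower.
  have hpnot : p ∉ Ideal.span {f, g} ⊔ Ideal.span {l} := by
    intro hmem
    obtain ⟨u, hu, v, hv, huv⟩ := Submodule.mem_sup.1 hmem
    obtain ⟨E, rfl⟩ := Ideal.mem_span_singleton.1 hv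
    have h1 := congrArg (homogeneousComponent j) huv
    rw [homogeneousComponent_eq_self hp, map_add] at h1
    apply hxj'
    rw [← h1, map_add, aff_eq_zero_of_mem (isHomog_span_pair h.hf h.hg u hu j), zero_add,
      homogeneousComponent_mul h.hl]
    split_ifs with hj1
    · rw [map_mul, aff_l, one_mul]
      have := aff_mem_filt (f := f) (g := g) (l := l)
        (homogeneousComponent_isHomogeneous (j - 1) E)
      rwa [Nat.sub_add_cancel hj1] at this
    · rw [map_zero]; exact zero_mem _
  obtain ⟨c, hc, hcp⟩ := h.exists_mul_notMem (m + 1 - j) hp (by omega) hpnot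
  refine ⟨aff f g l c, h.filt_mono (by omega) (aff_mem_filt hc), fun hmem => hcp ?_⟩
  rw [← map_mul, mul_comm] at hmem
  obtain ⟨q, hq, hqe⟩ := exists_of_mem_filt_succ hmem
  have hcph : (c * p).IsHomogeneous (m + 1) := by
    have := hc.mul hp
    rwa [Nat.sub_add_cancel (by omega)] at this
  have hlq : (l * q).IsHomogeneous (m + 1) := by rw [add_comm]; exact h.hl.mul hq
  have hz : c * p - l * q ∈ Ideal.span {f, g} := by
    rw [← h.aff_eq_zero_iff (hcph.sub hlq), map_sub, map_mul (aff f g l) l, aff_l, one_mul, hqe,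
      sub_self]
  have : c * p = (c * p - l * q) + l * q := by ring
  rw [this]
  exact Submodule.add_mem_sup hz (Ideal.mem_span_singleton.2 (dvd_mul_right _ _))

/-- The pairing `(x, y) ↦ lam (x y)`. -/
def pairing (lam : AffRing f g l →ₗ[ℂ] ℂ) : LinearMap.BilinForm ℂ (AffRing f g l) :=
  (LinearMap.mul ℂ (AffRing f g l)).compr₂ lam

@[simp] lemma pairing_apply (lam : AffRing f g l →ₗ[ℂ] ℂ) (x y : AffRing f g l) :
    pairing lam x y = lam (x * y) := rfl

lemma pairing_isSymm (lam : AffRing f g l →ₗ[ℂ] ℂ) : (pairing lam).IsSymm :=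
  ⟨fun x y => by rw [pairing_apply, pairing_apply, mul_comm]⟩

section functional

variable {lam : AffRing f g l →ₗ[ℂ] ℂ}

lemma IsCI.eq_zero_of_forall (h : IsCI f g l a b m)
    (hlam : ∀ x, lam x = 0 ↔ x ∈ filt f g l (m + 1)) {x : AffRing f g l}
    (hx : ∀ y, lam (x * y) = 0) : x = 0 := by
  by_contra hne
  obtain ⟨c, -, hc⟩ := h.exists_mul_notMem_filt (k := 0) (x := x) hne
  exact hc ((hlam _).1 (hx c))

lemma IsCI.pairing_nondegenerate (h : IsCI f g l a b m)
    (hlam : ∀ x, lam x = 0 ↔ x ∈ filt f g l (m + 1)) : (pairing lam).Nondegenerate :=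
  ⟨fun _ hx => h.eq_zero_of_forall hlam hx, fun _ hx => h.eq_zero_of_forall hlam fun y => by
    rw [mul_comm]; exact hx y⟩

/-- Products of the two steps have degree at most `m` and are killed by `lam`. Conversely, an
element outside the second step has a multiplier in the first that carries it out of the kernel. -/
lemma IsCI.orthogonal_filt (h : IsCI f g l a b m)
    (hlam : ∀ x, lam x = 0 ↔ x ∈ filt f g l (m + 1)) {s t : ℕ} (hst : s + t = m) :
    (pairing lam).orthogonal (filt f g l (s + 1)) = filt f g l (t + 1) := by
  ext x
  rw [LinearMap.BilinForm.mem_orthogonal_iff]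
  constructor
  · intro hx
    by_contra hne
    obtain ⟨c, hc, hxc⟩ := h.exists_mul_notMem_filt hne
    rw [show m + 2 - (t + 1) = s + 1 by omega] at hc
    apply hxc
    rw [← hlam, mul_comm]
    exact hx c hc
  · intro hx y hy
    rw [pairing_apply, hlam, ← hst]
    exact mul_mem_filt hy hx

end functional

/-- The image of an ideal in the affine coordinate ring. -/
def affImage (f g l : CoordRing) (I : Ideal CoordRing) : Submodule ℂ (AffRing f g l) :=
  (I.restrictScalars ℂ).map (aff f g l).toLinearMap

lemma mem_affImage {I : Ideal CoordRing} {x : AffRing f g l} :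
    x ∈ affImage f g l I ↔ ∃ i ∈ I, aff f g l i = x := Iff.rfl

lemma IsCI.aff_mem_affImage_iff (h : IsCI f g l a b m) {I : Ideal CoordRing} (hI : IsHomog I)
    (hle : Ideal.span {f, g} ≤ I) (hnz : ∀ p, l * p ∈ I → p ∈ I) {p : CoordRing} {t : ℕ}
    (hp : p.IsHomogeneous t) : aff f g l p ∈ affImage f g l I ↔ p ∈ I := by
  refine ⟨fun hmem => ?_, fun hmem => ⟨p, hmem, rfl⟩⟩
  obtain ⟨i, hi, hip⟩ := mem_affImage.1 hmem
  have h1 : p - i ∈ Ideal.span {f, g} ⊔ Ideal.span {l - 1} := by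
    rw [← aff_eq_zero, map_sub, hip, sub_self]
  refine mem_of_mem_sup_span_sub_one hI h.hl hnz hp ?_
  have h2 : p = (p - i) + i := by ring
  rw [h2]
  exact add_mem (sup_le_sup_right hle _ h1) (Submodule.mem_sup_left hi)

/-- The quotient of a filtration step by its intersection with the image of `I` is `(S/I)_t`.
Dimensions in the affine ring thus compute Hilbert functions. -/
lemma IsCI.hilb_add_finrank_inf (h : IsCI f g l a b m) {I : Ideal CoordRing} (hI : IsHomog I)
    (hle : Ideal.span {f, g} ≤ I) (hnz : ∀ p, l * p ∈ I → p ∈ I) (t : ℕ) :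
    hilb I t + Module.finrank ℂ (filt f g l (t + 1) ⊓ affImage f g l I :
      Submodule ℂ (AffRing f g l)) = hilb (Ideal.span {f, g}) t := by
  rw [← h.finrank_filt, ← finrank_map_add_finrank_inf_ker (Submodule.mkQ (affImage f g l I))
    (filt f g l (t + 1)), Submodule.ker_mkQ]
  congr 1
  set φ := (affImage f g l I).mkQ ∘ₗ (aff f g l).toLinearMap ∘ₗ (Forms t).subtype with hφ
  have h1 := LinearMap.finrank_range_add_finrank_ker φ
  have hr : LinearMap.range φ = (filt f g l (t + 1)).map (affImage f g l I).mkQ := by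
    rw [hφ, LinearMap.range_comp, LinearMap.range_comp, Submodule.range_subtype]; rfl
  have hk : LinearMap.ker φ = formsIn I t := by
    ext p
    rw [LinearMap.mem_ker]
    exact (Submodule.Quotient.mk_eq_zero _).trans (h.aff_mem_affImage_iff hI hle hnz p.2)
  have h2 := hilb_add_finrank I t
  rw [hr, hk, finrank_forms] at h1
  omega

section colon

variable {I : Ideal CoordRing}

lemma le_colon_of_mem {I : Ideal CoordRing} (T : Set CoordRing) : I ≤ I.colon T := by
  intro p hp
  rw [Submodule.mem_colon]
  intro s _
  exact I.mul_mem_right s hp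

lemma IsCI.nzd_colon (h : IsCI f g l a b m) (T : Set CoordRing) (p : CoordRing)
    (hp : l * p ∈ (Ideal.span {f, g}).colon T) : p ∈ (Ideal.span {f, g}).colon T := by
  rw [Submodule.mem_colon] at hp ⊢
  intro s hs
  refine h.nzd _ ?_
  have := hp s hs
  rwa [smul_eq_mul, mul_assoc] at this

variable {lam : AffRing f g l →ₗ[ℂ] ℂ}

/-- As `I` is an ideal, orthogonality of `p` to it gives `lam (p s y) = 0` for all `s` in `I` and
all `y`. By nondegeneracy `p s` vanishes in the affine ring. -/
lemma IsCI.aff_mem_orthogonal_iff (h : IsCI f g l a b m)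
    (hlam : ∀ x, lam x = 0 ↔ x ∈ filt f g l (m + 1)) (hI : IsHomog I) {p : CoordRing} {t : ℕ}
    (hp : p.IsHomogeneous t) : aff f g l p ∈ (pairing lam).orthogonal (affImage f g l I) ↔
      p ∈ (Ideal.span {f, g}).colon (I : Set CoordRing) := by
  rw [LinearMap.BilinForm.mem_orthogonal_iff, Submodule.mem_colon]
  constructor
  · intro hmem s hs
    rw [smul_eq_mul, ← sum_homogeneousComponent s, Finset.mul_sum]
    refine Submodule.sum_mem _ fun k _ => ?_
    rw [← h.aff_eq_zero_iff (hp.mul (homogeneousComponent_isHomogeneous k s))]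
    refine h.eq_zero_of_forall hlam fun y => ?_
    obtain ⟨v, rfl⟩ := aff_surjective y
    have := hmem (aff f g l (homogeneousComponent k s * v)) ⟨_, I.mul_mem_right v (hI s hs k), rfl⟩
    rw [pairing_apply, ← map_mul] at this
    rw [← map_mul, ← this]
    congr 2; ring
  · intro hmem x hx
    obtain ⟨i, hi, rfl⟩ := mem_affImage.1 hx
    rw [pairing_apply, ← map_mul, mul_comm, ← smul_eq_mul, aff_eq_zero_of_mem (hmem i hi), map_zero]

lemma IsCI.affImage_colon (h : IsCI f g l a b m)
    (hlam : ∀ x, lam x = 0 ↔ x ∈ filt f g l (m + 1)) (hI : IsHomog I) :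
    affImage f g l ((Ideal.span {f, g}).colon (I : Set CoordRing)) =
      (pairing lam).orthogonal (affImage f g l I) := by
  apply le_antisymm
  · rintro _ ⟨p, hp, rfl⟩
    rw [LinearMap.BilinForm.mem_orthogonal_iff]
    intro x hx
    obtain ⟨i, hi, rfl⟩ := mem_affImage.1 hx
    change lam (aff f g l i * aff f g l p) = 0
    rw [← map_mul, mul_comm, ← smul_eq_mul, aff_eq_zero_of_mem (Submodule.mem_colon.1 hp i hi), map_zero]
  · intro x hx
    have hx' : x ∈ filt f g l (m + 2) := by
      rw [h.filt_eq_top (by omega)]; exact Submodule.mem_top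
    obtain ⟨p, hp, rfl⟩ := exists_of_mem_filt_succ hx'
    exact ⟨p, (h.aff_mem_orthogonal_iff hlam hI hp).1 hx, rfl⟩

end colon

end

/-! ### Liaison duality and its numerical consequences -/

/-- Liaison duality for the ideals of plane zero-dimensional schemes that are linked by two curves
of degrees `a` and `b`. -/
theorem liaison {f g : CoordRing} {a b m : ℕ} (hf : f.IsHomogeneous a) (hg : g.IsHomogeneous b)
    (hf0 : f ≠ 0) (hg0 : g ≠ 0) (hfg : IsRelPrime f g) (ha : 0 < a) (hb : 0 < b)
    (hab : a + b = m + 3) {I : Ideal CoordRing} (hI : IsHomog I) (hIs : IsSat I) (hfI : f ∈ I)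
    (hgI : g ∈ I) {J : Ideal CoordRing} (hJ : J = (Ideal.span {f, g}).colon (I : Set CoordRing)) :
    IsHomog J ∧ IsSat J ∧ (Ideal.span {f, g}).colon (J : Set CoordRing) = I ∧
    ∃ n n' : ℕ, n + n' = a * b ∧ (∀ t, m < t → hilb I t = n ∧ hilb J t = n') ∧
      ∀ s t, s + t = m → hilb J t + Module.finrank ℂ (formsIn I s) =
        n' + Module.finrank ℂ (formsIn (Ideal.span {f, g}) s) := by
  obtain ⟨l, hl, hnz, hnzI⟩ := exists_linear_nzd (isSat_span_pair hf0 hfg) hIs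
  have h : IsCI f g l a b m := ⟨hf, hg, hf0, hg0, hfg, hl, hnz, ha, hb, hab⟩
  have hfin := h.finiteDimensional
  obtain ⟨lam, hlam⟩ := h.exists_functional
  have hle : Ideal.span {f, g} ≤ I := by
    rw [Ideal.span_le]
    rintro x (rfl | rfl)
    exacts [hfI, hgI]
  have hCI := isHomog_span_pair hf hg
  have hJh : IsHomog J := hJ ▸ hCI.colon hI
  have hJs : IsSat J := hJ ▸ (isSat_span_pair hf0 hfg).colon _
  have hJle : Ideal.span {f, g} ≤ J := hJ ▸ le_colon_of_mem _
  have hJnz : ∀ p, l * p ∈ J → p ∈ J := by rw [hJ]; exact h.nzd_colon _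
  have hJim := h.affImage_colon hlam hI
  rw [← hJ] at hJim
  have hnd := h.pairing_nondegenerate hlam
  have hsymm := pairing_isSymm lam
  have hdim := LinearMap.BilinForm.finrank_orthogonal hnd (affImage f g l I)
  have hD := h.finrank_affRing
  have hleD := Submodule.finrank_le (affImage f g l I)
  -- Beyond degree `m` the filtration is everything, so the lengths are the codimensions of the
  -- images of `I` and `J`. The latter image is the orthogonal of the former.
  refine ⟨hJh, hJs, ?_, a * b - Module.finrank ℂ (affImage f g l I),
    Module.finrank ℂ (affImage f g l I), by omega, ?_, ?_⟩
  · apply le_antisymm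
    · intro p hp
      refine IsHomog.mem_of_forall fun t => ?_
      have hpt := hCI.colon hJh p hp t
      rw [← h.aff_mem_orthogonal_iff hlam hJh (homogeneousComponent_isHomogeneous t p), hJim,
        LinearMap.BilinForm.orthogonal_orthogonal hnd hsymm.isRefl,
        h.aff_mem_affImage_iff hI hle hnzI (homogeneousComponent_isHomogeneous t p)] at hpt
      exact hpt
    · intro p hp
      rw [Submodule.mem_colon]
      intro s hs
      rw [SetLike.mem_coe, hJ, Submodule.mem_colon] at hs
      have := hs p hp
      rwa [smul_eq_mul, mul_comm] at this
  · intro t ht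
    have h1 := h.hilb_add_finrank_inf hI hle hnzI t
    have h2 := h.hilb_add_finrank_inf hJh hJle hJnz t
    rw [h.filt_eq_top (by omega), top_inf_eq, h.hilb_of_lt ht] at h1 h2
    rw [hJim, hdim] at h2
    omega
  · intro s t hst
    have h1 := h.hilb_add_finrank_inf hI hle hnzI s
    have h2 := h.hilb_add_finrank_inf hJh hJle hJnz t
    -- Both subspaces are orthogonals, so their intersection is the orthogonal of a sum; its
    -- dimension comes from the intersection for `I` in the dual degree `s`.
    have horth : filt f g l (t + 1) ⊓ affImage f g l J =
        (pairing lam).orthogonal (filt f g l (s + 1) ⊔ affImage f g l I) := by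
      rw [hJim, ← h.orthogonal_filt hlam hst]
      ext x
      simp only [Submodule.mem_inf, LinearMap.BilinForm.mem_orthogonal_iff]
      constructor
      · rintro ⟨hx, hy⟩ z hz
        obtain ⟨u, hu, v, hv, rfl⟩ := Submodule.mem_sup.1 hz
        rw [map_add, LinearMap.add_apply, hx u hu, hy v hv, add_zero]
      · intro hx
        exact ⟨fun u hu => hx u (Submodule.mem_sup_left hu),
          fun u hu => hx u (Submodule.mem_sup_right hu)⟩
    have h3 := LinearMap.BilinForm.finrank_orthogonal hnd (filt f g l (s + 1) ⊔ affImage f g l I)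
    have h4 := Submodule.finrank_sup_add_finrank_inf_eq (filt f g l (s + 1)) (affImage f g l I)
    have h5 := Submodule.finrank_le (filt f g l (s + 1) ⊔ affImage f g l I)
    have h6 := LinearMap.BilinForm.finrank_orthogonal hnd (filt f g l (s + 1))
    have h7 := Submodule.finrank_le (filt f g l (s + 1))
    rw [h.orthogonal_filt hlam hst] at h6
    have h8 := h.finrank_filt s
    have h9 := h.finrank_filt t
    have h10 := hilb_add_finrank I s
    have h11 := hilb_add_finrank (Ideal.span {f, g}) s
    rw [horth] at h2
    omega

namespace HilbPoints

variable {n : ℕ} (Z : HilbPoints n)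

lemma isHomog : IsHomog Z.ideal := Z.homogeneous

lemma isSat : IsSat Z.ideal := Z.saturated

lemma exists_hilb_eq : ∃ T, ∀ t, T ≤ t → hilb Z.ideal t = n :=
  Filter.eventually_atTop.1 Z.hilbertPolynomial

lemma hilb_le (t : ℕ) : hilb Z.ideal t ≤ n := by
  obtain ⟨T, hT⟩ := Z.exists_hilb_eq
  exact (hilb_mono Z.isSat (le_max_left t T)).trans (hT _ (le_max_right _ _)).le

lemma hilb_add_h0 (t : ℕ) : hilb Z.ideal t + Z.h0 t = tri (t + 1) := hilb_add_finrank Z.ideal t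

end HilbPoints

lemma exists_hilbPoints {I : Ideal CoordRing} (hI : IsHomog I) (hIs : IsSat I) {n T : ℕ}
    (h : ∀ t, T < t → hilb I t = n) : ∃ Z : HilbPoints n, Z.ideal = I :=
  ⟨⟨I, hI, hIs, Filter.eventually_atTop.2 ⟨T + 1, fun t ht => h t ht⟩⟩, rfl⟩

lemma finrank_formsIn_span_pair_of_lt {f g : CoordRing} {a b : ℕ} (hf : f.IsHomogeneous a)
    (hg : g.IsHomogeneous b) (hf0 : f ≠ 0) (hg0 : g ≠ 0) (hfg : IsRelPrime f g) {t : ℕ}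
    (hta : t < a) (htb : t < b) : Module.finrank ℂ (formsIn (Ideal.span {f, g}) t) = 0 := by
  have h := finrank_formsIn_span_pair hf hg hf0 hg0 hfg t
  rw [Nat.sub_eq_zero_of_le (by omega), Nat.sub_eq_zero_of_le (by omega),
    Nat.sub_eq_zero_of_le (by omega), tri_zero] at h
  exact h

lemma finrank_formsIn_span_pair_self {f g : CoordRing} {a b : ℕ} (hf : f.IsHomogeneous a)
    (hg : g.IsHomogeneous b) (hf0 : f ≠ 0) (hg0 : g ≠ 0) (hfg : IsRelPrime f g)
    (hab : a < b) : Module.finrank ℂ (formsIn (Ideal.span {f, g}) a) = 1 := by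
  have h := finrank_formsIn_span_pair hf hg hf0 hg0 hfg a
  rw [Nat.sub_eq_zero_of_le (show a + 1 ≤ b by omega),
    show a + 1 - (a + b) = 0 by omega, tri_zero, Nat.add_sub_cancel_left] at h
  exact h

/-- Duality with `m = 2r - 1`, in the dual degrees `r - 1` and `r`. The complete intersection has no
forms of degree `r - 1`, and the length of `Z'` is the number of monomials of degree `r`. -/
lemma AreResidual.h0_eq {r : ℕ} (hr : 1 ≤ r) {Z : HilbPoints (tri r)}
    {Z' : HilbPoints (tri (r + 1))} (h : AreResidual (r + 1) Z Z') : Z'.h0 r = Z.h0 (r - 1) := by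
  obtain ⟨f, g, hf0, hg0, hf, hg, hfg, hfZ, hgZ, hZ'⟩ := h
  obtain ⟨-, -, -, n, n', -, hn, hd⟩ := liaison (m := 2 * r - 1) hf hg hf0 hg0 hfg (by omega)
    (by omega) (by omega) Z.isHomog Z.isSat hfZ hgZ hZ'
  obtain ⟨T, hT⟩ := Z'.exists_hilb_eq
  have h1 := (hn (max T (2 * r)) (lt_of_lt_of_le (by omega) (le_max_right _ _))).2
  rw [hT _ (le_max_left _ _)] at h1
  have h2 := hd (r - 1) r (by omega)
  rw [finrank_formsIn_span_pair_of_lt hf hg hf0 hg0 hfg (by omega) (by omega)] at h2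
  have h3 := Z'.hilb_add_h0 r
  change _ + Z.h0 (r - 1) = _ at h2
  omega

/-- Linkage is an involution, and `(r + 1)² - d_{r+1} = d_r`. -/
lemma exists_residual {r : ℕ} (hr : 1 ≤ r) (Z' : HilbPoints (tri (r + 1))) {f g : CoordRing}
    (hf : f.IsHomogeneous (r + 1)) (hg : g.IsHomogeneous (r + 1)) (hf0 : f ≠ 0) (hg0 : g ≠ 0)
    (hfg : IsRelPrime f g) (hfZ : f ∈ Z'.ideal) (hgZ : g ∈ Z'.ideal) :
    ∃ Z : HilbPoints (tri r), AreResidual (r + 1) Z Z' := by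
  obtain ⟨hJ, hJs, hJJ, n, n', hnn, hn, -⟩ := liaison (m := 2 * r - 1) hf hg hf0 hg0 hfg
    (by omega) (by omega) (by omega) Z'.isHomog Z'.isSat hfZ hgZ rfl
  obtain ⟨T, hT⟩ := Z'.exists_hilb_eq
  have h1 := (hn (max T (2 * r)) (lt_of_lt_of_le (by omega) (le_max_right _ _))).1
  rw [hT _ (le_max_left _ _)] at h1
  have h2 := two_mul_tri r
  have h3 := two_mul_tri (r + 1)
  obtain rfl : n' = tri r := by nlinarith
  obtain ⟨Z, hZ⟩ := exists_hilbPoints hJ hJs fun t ht => (hn t ht).2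
  refine ⟨Z, f, g, hf0, hg0, hf, hg, hfg, ?_, ?_, by rw [hZ, hJJ]⟩
  · rw [hZ]; exact le_colon_of_mem _ (Ideal.subset_span (by simp))
  · rw [hZ]; exact le_colon_of_mem _ (Ideal.subset_span (by simp))

lemma finrank_formsIn_ge_of_mem {I : Ideal CoordRing} {q : CoordRing} {a : ℕ}
    (hq : q.IsHomogeneous a) (hq0 : q ≠ 0) (hqI : q ∈ I) (t : ℕ) :
    tri (t + 1 - a) ≤ Module.finrank ℂ (formsIn I t) := by
  rw [← finrank_formsIn_span_singleton hq hq0]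
  exact Submodule.finrank_mono (formsIn_mono ((Ideal.span_singleton_le_iff_mem I).2 hqI) t)

lemma exists_mem_formsIn_ne_zero {I : Ideal CoordRing} {t : ℕ}
    (h : Module.finrank ℂ (formsIn I t) ≠ 0) : ∃ q ∈ I, q.IsHomogeneous t ∧ q ≠ 0 := by
  obtain ⟨q, hq, hq0⟩ := Submodule.exists_mem_ne_zero_of_ne_bot
    (fun hbot => h (Submodule.finrank_eq_zero.2 hbot))
  exact ⟨q, hq, q.2, fun h0 => hq0 (Subtype.ext h0)⟩

/-- A form of degree `r - 1` would have a three-dimensional space of multiples in degree `r`. -/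
lemma finrank_formsIn_pred_eq_zero {I : Ideal CoordRing} {r : ℕ} (hr : 1 ≤ r)
    (h : Module.finrank ℂ (formsIn I r) = 1) : Module.finrank ℂ (formsIn I (r - 1)) = 0 := by
  by_contra hne
  obtain ⟨q, hqI, hq, hq0⟩ := exists_mem_formsIn_ne_zero hne
  have h1 := finrank_formsIn_ge_of_mem hq hq0 hqI r
  rw [h, show r + 1 - (r - 1) = 2 by omega] at h1
  exact absurd h1 (by decide)

/-- The Hilbert function of a member of `D_r`. -/
lemma hilb_of_mem_locusD {r : ℕ} {Z : HilbPoints (tri (r + 1))} (hZ : Z ∈ locusD (tri (r + 1)) r)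
    {t : ℕ} (ht : r < t) : hilb Z.ideal t = tri (r + 1) := by
  have h1 : Z.h0 r = 1 := hZ
  have h2 := Z.hilb_add_h0 r
  have h3 := Z.hilb_le (r + 1)
  have h4 := hilb_mono Z.isSat (Nat.le_succ r)
  obtain ⟨T, hT⟩ := Z.exists_hilb_eq
  -- A repeated value would be final, but the value at `r` is one less than the length.
  have h5 : hilb Z.ideal r ≠ hilb Z.ideal (r + 1) := by
    intro h
    have := hilb_eq_of_le Z.isSat h (le_max_left r T)
    rw [hT _ (le_max_right _ _)] at this
    omega
  have h6 := hilb_mono Z.isSat (show r + 1 ≤ t from ht)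
  have h7 := Z.hilb_le t
  simp only [Nat.succ_eq_add_one] at h4
  omega

/-! ### Common factors and fixed components of linear systems -/

lemma not_isUnit_of_isHomogeneous {g : CoordRing} {b : ℕ} (hg : g.IsHomogeneous b) (hb : 0 < b) :
    ¬ IsUnit g := by
  intro hu
  obtain ⟨c, -, rfl⟩ := MvPolynomial.isUnit_iff_eq_C_of_isReduced.1 hu
  have := hg.inj_right (isHomogeneous_C _ c) hu.ne_zero
  omega

lemma exists_isHomogeneous_of_irreducible_dvd {p f : CoordRing} {d : ℕ} (hf : f.IsHomogeneous d)
    (hf0 : f ≠ 0) (hp : Irreducible p) (h : p ∣ f) :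
    ∃ e, 1 ≤ e ∧ e ≤ d ∧ p.IsHomogeneous e := by
  obtain ⟨e, he⟩ := isHomogeneous_of_dvd hf hf0 h
  obtain ⟨q, rfl⟩ := h
  obtain ⟨b, hb, -⟩ := isHomogeneous_of_mul he hp.ne_zero (right_ne_zero_of_mul hf0) hf
  refine ⟨e, Nat.one_le_iff_ne_zero.2 ?_, by omega, he⟩
  rintro rfl
  rw [← totalDegree_zero_iff_isHomogeneous, totalDegree_eq_zero_iff_eq_C] at he
  apply hp.not_isUnit
  rw [he]
  refine (IsUnit.mk0 _ ?_).map C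
  intro h0
  rw [h0, C_0] at he
  exact hp.ne_zero he

lemma dvd_of_forall_dvd_X_mul {p q : CoordRing} (hp : Irreducible p)
    (h : ∀ i : Fin 3, p ∣ X i * q) : p ∣ q := by
  by_contra hq
  have h0 := (hp.prime.dvd_or_dvd (h 0)).resolve_right hq
  have h1 := (hp.prime.dvd_or_dvd (h 1)).resolve_right hq
  have h2 : (X 0 : CoordRing) ∣ p :=
    ((hp.associated_of_dvd (X_prime : Prime (X 0 : CoordRing)).irreducible h0).symm).dvd
  exact not_X_dvd_X (by decide : (0 : Fin 3) ≠ 1) (h2.trans h1)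

lemma dvd_formsIn_of_succ {I : Ideal CoordRing} {p : CoordRing} (hp : Irreducible p) {t : ℕ}
    (h : ∀ q ∈ I, q.IsHomogeneous (t + 1) → p ∣ q) : ∀ q ∈ I, q.IsHomogeneous t → p ∣ q :=
  fun q hq hqt => dvd_of_forall_dvd_X_mul hp fun i => h _ (I.mul_mem_left _ hq) (by
    rw [add_comm]; exact (isHomogeneous_X _ i).mul hqt)

lemma finrank_map_of_injective {V W : Type*} [AddCommGroup V] [Module ℂ V]
    [AddCommGroup W] [Module ℂ W] {φ : V →ₗ[ℂ] W} (hφ : Function.Injective φ)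
    (p : Submodule ℂ V) : Module.finrank ℂ (p.map φ) = Module.finrank ℂ p :=
  (Submodule.equivMapOfInjective φ hφ p).finrank_eq.symm

/-- When `p` divides every form of degree `t` in `I`, multiplication by `p` identifies `(I : p)_u`
with `I_t`. -/
lemma finrank_formsIn_colon {I : Ideal CoordRing} {p : CoordRing} {e u t : ℕ}
    (hp : p.IsHomogeneous e) (hp0 : p ≠ 0) (het : e + u = t)
    (h : ∀ q ∈ I, q.IsHomogeneous t → p ∣ q) :
    Module.finrank ℂ (formsIn (I.colon (Ideal.span {p} : Set CoordRing)) u) =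
      Module.finrank ℂ (formsIn I t) := by
  have hinj := mulForm_injective het (f := ⟨p, hp⟩) hp0
  rw [← finrank_map_of_injective hinj]
  suffices hmap : (formsIn (I.colon (Ideal.span {p} : Set CoordRing)) u).map
      (mulForm het ⟨p, hp⟩) = formsIn I t by rw [hmap]
  apply le_antisymm
  · rintro _ ⟨k, hk, rfl⟩
    have := Submodule.mem_colon.1 hk p (Ideal.mem_span_singleton_self p)
    rw [smul_eq_mul, mul_comm] at this
    exact this
  · intro q hq
    obtain ⟨k, hk⟩ := h q hq q.2
    have hkh : k.IsHomogeneous u := isHomogeneous_of_mul_add hp hp0 (by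
      rw [← hk, het]; exact q.2)
    refine ⟨⟨k, hkh⟩, ?_, Subtype.ext hk.symm⟩
    change k ∈ I.colon (Ideal.span {p} : Set CoordRing)
    rw [Submodule.mem_colon]
    intro s hs
    obtain ⟨c, rfl⟩ := Ideal.mem_span_singleton.1 hs
    have : k • (p * c) = c * q := by rw [hk, smul_eq_mul]; ring
    rw [this]
    exact I.mul_mem_left _ hq

/-- A fixed component of a linear system forces the Hilbert function to grow. -/
lemma exists_not_dvd_of_hilb_eq {I : Ideal CoordRing} (hIs : IsSat I)
    {t : ℕ} (ht : hilb I t = hilb I (t + 1)) {p : CoordRing} (hp : Irreducible p) {e : ℕ}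
    (hpe : p.IsHomogeneous e) (he : 1 ≤ e) (het : e ≤ t) :
    ∃ q ∈ I, q.IsHomogeneous (t + 1) ∧ ¬ p ∣ q := by
  by_contra! hcon
  have h1 := finrank_formsIn_colon (u := t + 1 - e) hpe hp.ne_zero (by omega) hcon
  have h2 := finrank_formsIn_colon (u := t - e) hpe hp.ne_zero (by omega)
    (dvd_formsIn_of_succ hp hcon)
  have h3 := hilb_le_succ (hIs.colon (Ideal.span {p} : Set CoordRing)) (t - e)
  have h4 := hilb_add_finrank (I.colon (Ideal.span {p} : Set CoordRing)) (t - e)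
  have h5 := hilb_add_finrank (I.colon (Ideal.span {p} : Set CoordRing)) (t - e + 1)
  have h6 := hilb_add_finrank I t
  have h7 := hilb_add_finrank I (t + 1)
  rw [show t + 1 - e = t - e + 1 by omega] at h1
  rw [tri_succ (t - e + 1)] at h5
  rw [tri_succ (t + 1)] at h7
  omega

/-- The multiples of each irreducible factor of `f` form a proper subspace of the system; finitely
many proper subspaces over `ℂ` do not cover it. -/
lemma exists_isRelPrime {I : Ideal CoordRing} {t : ℕ} {f : CoordRing} (hf0 : f ≠ 0)
    (h : ∀ p, Irreducible p → p ∣ f → ∃ q ∈ I, q.IsHomogeneous t ∧ ¬ p ∣ q) :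
    ∃ g ∈ I, g.IsHomogeneous t ∧ IsRelPrime f g := by
  classical
  let A : CoordRing → Submodule ℂ (formsIn I t) := fun p =>
    (formsIn (Ideal.span {p}) t).comap (formsIn I t).subtype
  have hne := Subspace.biUnion_ne_univ_of_top_notMem (k := ℂ) (E := formsIn I t)
    (s := (UniqueFactorizationMonoid.factors f).toFinset.image A) (by
      simp only [Finset.mem_image, Multiset.mem_toFinset, not_exists, not_and]
      intro p hp htop
      obtain ⟨q, hqI, hq, hpq⟩ := h p (UniqueFactorizationMonoid.irreducible_of_factor p hp)
        (UniqueFactorizationMonoid.dvd_of_mem_factors hp)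
      have : (⟨⟨q, hq⟩, hqI⟩ : formsIn I t) ∈ A p := htop ▸ Submodule.mem_top
      exact hpq (Ideal.mem_span_singleton.1 this))
  obtain ⟨g, hg⟩ := (Set.ne_univ_iff_exists_notMem _).1 hne
  simp only [Finset.mem_image, Multiset.mem_toFinset, Set.mem_iUnion, not_exists,
    SetLike.mem_coe] at hg
  refine ⟨g.1.1, g.2, g.1.2, ?_⟩
  intro d hdf hdg
  by_contra hu
  obtain ⟨p, hp, hpd⟩ := WfDvdMonoid.exists_irreducible_factor hu (ne_zero_of_dvd_ne_zero hf0 hdf)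
  obtain ⟨q, hq, hpq⟩ := UniqueFactorizationMonoid.exists_mem_factors_of_dvd hf0 hp
    (hpd.trans hdf)
  exact hg _ ⟨q, hq, rfl⟩ (Ideal.mem_span_singleton.2 (hpq.symm.dvd.trans (hpd.trans hdg)))

/-- If the curves of degree `r + 1` through a member of `D_r` have a fixed component, then this is
a line, and the residual of the unique curve of degree `r` with respect to the line lies in the
linked ideal. -/
lemma exists_factor_of_dvd {r : ℕ} {J : Ideal CoordRing} (hJ : IsHomog J) (hJs : IsSat J)
    (hJr : Module.finrank ℂ (formsIn J r) = 1) (hn : ∀ t, r < t → hilb J t = tri (r + 1))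
    {f g : CoordRing} (hf : f.IsHomogeneous r) (hg : g.IsHomogeneous (r + 2)) (hf0 : f ≠ 0)
    (hfg : IsRelPrime f g) (hfJ : f ∈ J) (hgJ : g ∈ J) {p : CoordRing} (hp : Irreducible p)
    (hdvd : ∀ q ∈ J, q.IsHomogeneous (r + 1) → p ∣ q) :
    ∃ q ∈ (Ideal.span {f, g}).colon (J : Set CoordRing), q.IsHomogeneous (r - 1) ∧ q ∣ f := by
  have hpf : p ∣ f := dvd_formsIn_of_succ hp hdvd f hfJ hf
  obtain ⟨e, he1, her, hpe⟩ := exists_isHomogeneous_of_irreducible_dvd hf hf0 hp hpf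
  set K := J.colon (Ideal.span {p} : Set CoordRing) with hK
  have hKs : IsSat K := hJs.colon _
  have d1 := finrank_formsIn_colon (u := r - e + 1) hpe hp.ne_zero (by omega) hdvd
  have d2 := finrank_formsIn_colon (u := r - e) hpe hp.ne_zero (by omega)
    (dvd_formsIn_of_succ hp hdvd)
  rw [← hK] at d1 d2
  have h3 := hilb_le_succ hKs (r - e)
  have h4 := hilb_add_finrank K (r - e)
  have h5 := hilb_add_finrank K (r - e + 1)
  have h6 := hilb_add_finrank J (r + 1)
  have h7 := hn (r + 1) (by omega)
  rw [tri_succ (r - e + 1)] at h5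
  rw [tri_succ (r + 1)] at h6
  -- Dimensions `1` and `r + 2` for `K` in degrees `r - e` and `r - e + 1` are compatible with a
  -- nondecreasing Hilbert function only if `e = 1`. The two values are then equal, so this function
  -- is constant from there on.
  have he : e = 1 := by omega
  subst he
  have hKeq : hilb K (r - 1) = hilb K (r - 1 + 1) := by omega
  have hK1 : hilb K (r + 1) = hilb K (r - 1) := hilb_eq_of_le hKs hKeq (by omega)
  obtain ⟨w, hw⟩ := hpf
  have hwh : w.IsHomogeneous (r - 1) := isHomogeneous_of_mul_add hpe hp.ne_zero (by
    rw [← hw, show 1 + (r - 1) = r by omega]; exact hf)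
  have hfspan : f ∈ Ideal.span {f, g} := Ideal.subset_span (by simp)
  have hgspan : g ∈ Ideal.span {f, g} := Ideal.subset_span (by simp)
  have hofdvd : ∀ q, p ∣ q → w * q ∈ Ideal.span {f, g} := by
    rintro _ ⟨q, rfl⟩
    have : w * (p * q) = q * f := by rw [hw]; ring
    rw [this]; exact Ideal.mul_mem_left _ _ hfspan
  have hlow : ∀ k t, t + k = r + 1 → ∀ q ∈ J, q.IsHomogeneous t → p ∣ q := by
    intro k
    induction k with
    | zero => rintro t rfl; exact hdvd
    | succ k ih => intro t ht; exact dvd_formsIn_of_succ hp (ih (t + 1) (by omega))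
  -- The space `p K_{r+1}` has codimension one in `J_{r+2}`, and `g`, not divisible by `p`, fills
  -- the gap. Multiplication by `w = f / p` sends multiples of `p` to multiples of `f`.
  have hmid : ∀ q ∈ J, q.IsHomogeneous (r + 2) → w * q ∈ Ideal.span {f, g} := by
    set φ := mulForm (show 1 + (r + 1) = r + 2 by omega) ⟨p, hpe⟩ with hφ
    have hinj : Function.Injective φ := mulForm_injective _ hp.ne_zero
    set V := (formsIn K (r + 1)).map φ with hV
    have hdimV : Module.finrank ℂ V = Module.finrank ℂ (formsIn K (r + 1)) :=
      finrank_map_of_injective hinj _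
    have hVJ : V ≤ formsIn J (r + 2) := by
      rintro _ ⟨k, hk, rfl⟩
      have := Submodule.mem_colon.1 hk p (Ideal.mem_span_singleton_self p)
      rw [smul_eq_mul, mul_comm] at this
      exact this
    have hVdvd : ∀ v ∈ V, p ∣ (v : CoordRing) := by
      rintro _ ⟨k, hk, rfl⟩; exact dvd_mul_right _ _
    have hgV : (⟨g, hg⟩ : Forms (r + 2)) ∉ V := fun hmem =>
      hp.not_isUnit (hfg ⟨w, hw⟩ (hVdvd _ hmem))
    have hlt : V < V ⊔ Submodule.span ℂ {(⟨g, hg⟩ : Forms (r + 2))} :=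
      lt_of_le_of_ne le_sup_left fun heq => hgV (by
        rw [heq]; exact Submodule.mem_sup_right (Submodule.mem_span_singleton_self _))
    have hle : V ⊔ Submodule.span ℂ {(⟨g, hg⟩ : Forms (r + 2))} ≤ formsIn J (r + 2) := by
      refine sup_le hVJ ?_
      rw [Submodule.span_singleton_le_iff_mem]
      exact hgJ
    have hfr := Submodule.finrank_lt_finrank_of_lt hlt
    have e1 := hilb_add_finrank K (r + 1)
    have e2 := hilb_add_finrank J (r + 2)
    have e3 := hn (r + 2) (by omega)
    rw [tri_succ (r + 2), tri_succ (r + 1)] at e2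
    rw [tri_succ (r + 1), tri_succ r] at e1
    rw [tri_succ r] at e2 e3
    have e4 : tri (r - 1 + 1) = tri r := by rw [Nat.sub_add_cancel her]
    have heq := Submodule.eq_of_le_of_finrank_le hle (by omega)
    intro q hq hqh
    have hmem : (⟨q, hqh⟩ : Forms (r + 2)) ∈ V ⊔ Submodule.span ℂ {(⟨g, hg⟩ : Forms (r + 2))} := by
      rw [heq]; exact hq
    obtain ⟨v, hv, y, hy, hvy⟩ := Submodule.mem_sup.1 hmem
    obtain ⟨c, rfl⟩ := Submodule.mem_span_singleton.1 hy
    have hq' : q = (v : CoordRing) + C c * g := by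
      rw [← smul_eq_C_mul]; exact (congrArg Subtype.val hvy).symm
    rw [hq', mul_add]
    exact add_mem (hofdvd _ (hVdvd v hv))
      (Ideal.mul_mem_left _ _ (Ideal.mul_mem_left _ _ hgspan))
  -- From degree `r + 2` on, `J` is generated by its forms of degree `r + 2`, as its Hilbert
  -- function already repeats at `r + 1`.
  have hhigh : ∀ k, ∀ q ∈ J, q.IsHomogeneous (r + 2 + k) → w * q ∈ Ideal.span {f, g} := by
    intro k
    induction k with
    | zero => exact hmid
    | succ k ih =>
      intro q hq hqh
      obtain ⟨u, hu, v, hv, hvh, l, -, rfl⟩ := mem_span_of_hilb_eq (t := r + 1 + k) hJs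
        (by rw [hn _ (by omega), hn _ (by omega)])
        (by convert hqh using 1; omega) hq
      have er : r + 1 + k + 1 = r + 2 + k := by omega
      rw [er] at hu hvh
      have : w * (∑ i, X i * u i + l * v) = ∑ i, X i * (w * u i) + l * (w * v) := by
        rw [mul_add, Finset.mul_sum]
        congr 1
        · exact Finset.sum_congr rfl fun i _ => by ring
        · ring
      rw [this]
      exact add_mem (Submodule.sum_mem _ fun i _ => Ideal.mul_mem_left _ _ (ih _ (hu i).2 (hu i).1))
        (Ideal.mul_mem_left _ _ (ih _ hv hvh))
  refine ⟨w, ?_, hwh, ⟨p, by rw [hw]; ring⟩⟩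
  rw [Submodule.mem_colon]
  intro s hs
  rw [smul_eq_mul, ← sum_homogeneousComponent s, Finset.mul_sum]
  refine Submodule.sum_mem _ fun t _ => ?_
  have hst := homogeneousComponent_isHomogeneous t s
  rcases le_or_gt t (r + 1) with ht | ht
  · exact hofdvd _ (hlow (r + 1 - t) t (by omega) _ (hJ s hs t) hst)
  · obtain ⟨k, hk⟩ := Nat.exists_eq_add_of_le (show r + 2 ≤ t from ht)
    rw [hk] at hst ⊢
    exact hhigh k _ (hJ s hs _) hst

/-! ### The good locus and the pencil of links -/

/-- The schemes on which the curves of degree `r + 1` impose independent conditions and that lie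
on two such curves without common component. -/
def goodLocus (r : ℕ) : Set (HilbPoints (tri (r + 1))) :=
  {Z | hilb Z.ideal (r + 1) = tri (r + 1) ∧ ∃ f ∈ Z.ideal, ∃ g ∈ Z.ideal,
    f.IsHomogeneous (r + 1) ∧ g.IsHomogeneous (r + 1) ∧ f ≠ 0 ∧ g ≠ 0 ∧ IsRelPrime f g}

lemma goodLocus_inter_subset {r : ℕ} (hr : 1 ≤ r) :
    goodLocus r ∩ locusD (tri (r + 1)) r ⊆ residualFamily r (locusD (tri r) (r - 1)) := by
  rintro Z' ⟨⟨-, f, hfZ, g, hgZ, hf, hg, hf0, hg0, hfg⟩, hZ'⟩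
  obtain ⟨Z, hZ⟩ := exists_residual hr Z' hf hg hf0 hg0 hfg hfZ hgZ
  exact ⟨Z, (hZ.h0_eq hr).symm.trans hZ', hZ⟩

/-- An irreducible factor of `g` dividing two members of the pencil would divide `f'`, hence `f`. So
each factor of `g` spoils at most one parameter. -/
lemma finite_not_isRelPrime {f f' g : CoordRing} (hg0 : g ≠ 0) (hfg : IsRelPrime f g) :
    {s : ℂ | ¬ IsRelPrime (f + C s * f') g}.Finite := by
  classical
  have hex : ∀ s : ℂ, ∃ p, ¬ IsRelPrime (f + C s * f') g →
      p ∈ UniqueFactorizationMonoid.factors g ∧ p ∣ f + C s * f' := by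
    intro s
    by_cases hs : IsRelPrime (f + C s * f') g
    · exact ⟨0, fun h => absurd hs h⟩
    · simp only [IsRelPrime, not_forall] at hs
      obtain ⟨d, hd1, hd2, hu⟩ := hs
      obtain ⟨p, hp, hpd⟩ := WfDvdMonoid.exists_irreducible_factor hu (ne_zero_of_dvd_ne_zero hg0 hd2)
      obtain ⟨q, hq, hpq⟩ := UniqueFactorizationMonoid.exists_mem_factors_of_dvd hg0 hp
        (hpd.trans hd2)
      exact ⟨q, fun _ => ⟨hq, hpq.symm.dvd.trans (hpd.trans hd1)⟩⟩
  choose p hp using hex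
  refine Set.Finite.of_finite_image (f := p)
    ((UniqueFactorizationMonoid.factors g).toFinset.finite_toSet.subset ?_) ?_
  · rintro _ ⟨s, hs, rfl⟩
    exact Multiset.mem_toFinset.2 (hp s hs).1
  · intro s hs t ht hst
    by_contra hne
    have h1 := (hp s hs).2
    have h2 := (hp t ht).2
    rw [← hst] at h2
    have hpr := UniqueFactorizationMonoid.irreducible_of_factor _ (hp s hs).1
    have h3 : p s ∣ C (s - t) * f' := by
      have := dvd_sub h1 h2
      have e : f + C s * f' - (f + C t * f') = C (s - t) * f' := by rw [C_sub]; ring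
      rwa [e] at this
    have hu : IsUnit (C (s - t) : CoordRing) := (IsUnit.mk0 _ (sub_ne_zero.2 hne)).map C
    have h4 : p s ∣ f' := (hu.dvd_mul_left).1 h3
    have h5 : p s ∣ f := (dvd_add_left (dvd_mul_of_dvd_right h4 _)).1 h1
    exact hpr.not_isUnit (hfg h5 (UniqueFactorizationMonoid.dvd_of_mem_factors (hp s hs).1))

/-- If the system of degree `r + 1` has no fixed component, one curve of the pair may be `x₀ f`, and
a general member serves as the other. -/
lemma exists_common_coprime_pair {r : ℕ} {J : Ideal CoordRing} {f : CoordRing}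
    (hf : f.IsHomogeneous r) (hf0 : f ≠ 0) (hfJ : f ∈ J)
    (h : ∀ p, Irreducible p → ∃ q ∈ J, q.IsHomogeneous (r + 1) ∧ ¬ p ∣ q) :
    ∃ u ∈ J, ∃ v ∈ J, u.IsHomogeneous (r + 1) ∧ v.IsHomogeneous (r + 1) ∧ u ≠ 0 ∧ v ≠ 0 ∧
      IsRelPrime u v := by
  have hu : (X 0 * f).IsHomogeneous (r + 1) := by rw [add_comm]; exact (isHomogeneous_X _ 0).mul hf
  have hu0 : X 0 * f ≠ 0 := mul_ne_zero (X_ne_zero 0) hf0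
  obtain ⟨v, hvJ, hv, huv⟩ := exists_isRelPrime hu0 fun p hp _ => h p hp
  refine ⟨X 0 * f, J.mul_mem_left _ hfJ, v, hvJ, hu, hv, hu0, ?_, huv⟩
  rintro rfl
  exact not_isUnit_of_isHomogeneous hu (by omega) (isRelPrime_zero_right.1 huv)

/-- Linking a scheme `W` of length `d_r - 1` with maximal Hilbert function by curves of degrees `r`
and `r + 2` gives a member of `D_r`. It lies on two curves of degree `r + 1` without common component
if the curve of degree `r` does not contain the curve of degree `r - 1` through `W`. -/
lemma exists_linked_hilbPoints {r : ℕ} (hr : 2 ≤ r) {K : Ideal CoordRing} (hK : IsHomog K)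
    (hKs : IsSat K) (hK1 : hilb K (r - 1) = hilb K r)
    (hd : Module.finrank ℂ (formsIn K (r - 1)) = 1) {f g : CoordRing} (hf : f.IsHomogeneous r)
    (hg : g.IsHomogeneous (r + 2)) (hf0 : f ≠ 0) (hg0 : g ≠ 0) (hfg : IsRelPrime f g)
    (hfK : f ∈ K) (hgK : g ∈ K)
    (hndvd : ∀ q ∈ K, q.IsHomogeneous (r - 1) → ¬ q ∣ f) :
    ∃ W : HilbPoints (tri (r + 1)), W.ideal = (Ideal.span {f, g}).colon (K : Set CoordRing) ∧
      W ∈ locusD (tri (r + 1)) r ∧ W ∈ goodLocus r := by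
  obtain ⟨hJ, hJs, hJJ, n, n', hnn, hn, hlink⟩ := liaison (m := 2 * r - 1) hf hg hf0 hg0 hfg
    (by omega) (by omega) (by omega) hK hKs hfK hgK rfl
  have hr1 : r - 1 + 1 = r := by omega
  have h1 := hilb_eq_of_le hKs (t := r - 1) (by rw [hr1]; exact hK1) (show r - 1 ≤ 2 * r by omega)
  -- The length of `K` is its stable value `d_r - 1`, so the linked scheme has length `r(r + 2) -
  -- (d_r - 1) = d_{r+1}`.
  rw [(hn (2 * r) (by omega)).1] at h1
  have h2 := hilb_add_finrank K (r - 1)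
  rw [hr1] at h2
  have h3 := two_mul_tri r
  have h4 := two_mul_tri (r + 1)
  obtain rfl : n' = tri (r + 1) := by nlinarith
  obtain ⟨W, hW⟩ := exists_hilbPoints hJ hJs fun t ht => (hn t ht).2
  have h5 := hlink (r - 1) r (by omega)
  rw [finrank_formsIn_span_pair_of_lt hf hg hf0 hg0 hfg (by omega) (by omega)] at h5
  have h6 := W.hilb_add_h0 r
  rw [hW] at h6
  have hWD : W ∈ locusD (tri (r + 1)) r := by change W.h0 r = 1; omega
  have hfW : f ∈ W.ideal := by rw [hW]; exact le_colon_of_mem _ (Ideal.subset_span (by simp))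
  have hgW : g ∈ W.ideal := by rw [hW]; exact le_colon_of_mem _ (Ideal.subset_span (by simp))
  refine ⟨W, hW, hWD, hilb_of_mem_locusD hWD (by omega),
    exists_common_coprime_pair hf hf0 hfW fun p hp => ?_⟩
  by_contra! hcon
  obtain ⟨q, hq, hqh, hqf⟩ := exists_factor_of_dvd W.isHomog W.isSat hWD
    (fun t ht => hilb_of_mem_locusD hWD ht) hf hg hf0 hfg hfW hgW hp hcon
  rw [hW, hJJ] at hq
  exact hndvd q hq hqh hqf

/-- A member of `D_r` is linked by curves of degrees `r` and `r + 2` to a scheme with maximal Hilbert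
function, and moving the curve of degree `r` deforms it into the good locus. -/
lemma exists_pencil {r : ℕ} (hr : 2 ≤ r) {Z : HilbPoints (tri (r + 1))}
    (hZ : Z ∈ locusD (tri (r + 1)) r) : ∃ (K : Ideal CoordRing) (f f' g : CoordRing),
      IsHomog K ∧ IsSat K ∧ hilb K (r - 1) = hilb K r ∧ f.IsHomogeneous r ∧ f'.IsHomogeneous r ∧
      g.IsHomogeneous (r + 2) ∧ f ≠ 0 ∧ g ≠ 0 ∧ IsRelPrime f g ∧
      Z.ideal = (Ideal.span {f, g}).colon (K : Set CoordRing) ∧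
      ∀ᶠ s : ℂ in Filter.cofinite, f + C s * f' ≠ 0 ∧ IsRelPrime (f + C s * f') g ∧
        ∃ W : HilbPoints (tri (r + 1)),
          W.ideal = (Ideal.span {f + C s * f', g}).colon (K : Set CoordRing) ∧
          W ∈ locusD (tri (r + 1)) r ∧ W ∈ goodLocus r := by
  have hZr : Module.finrank ℂ (formsIn Z.ideal r) = 1 := hZ
  obtain ⟨f, hfZ, hf, hf0⟩ := exists_mem_formsIn_ne_zero (I := Z.ideal) (t := r) (by omega)
  obtain ⟨g, hgZ, hg, hfg⟩ := exists_isRelPrime (I := Z.ideal) (t := r + 2) hf0 (by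
    intro p hp hpf
    obtain ⟨e, he1, her, hpe⟩ := exists_isHomogeneous_of_irreducible_dvd hf hf0 hp hpf
    exact exists_not_dvd_of_hilb_eq Z.isSat (t := r + 1)
      (by rw [hilb_of_mem_locusD hZ (by omega), hilb_of_mem_locusD hZ (by omega)]) hp hpe he1
      (by omega))
  have hg0 : g ≠ 0 := by
    rintro rfl
    exact not_isUnit_of_isHomogeneous hf (by omega) (isRelPrime_zero_right.1 hfg)
  obtain ⟨hK, hKs, hKK, n, n', hnn, hn, hlink⟩ := liaison (m := 2 * r - 1) hf hg hf0 hg0 hfg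
    (by omega) (by omega) (by omega) Z.isHomog Z.isSat hfZ hgZ rfl
  set K := (Ideal.span {f, g}).colon (Z.ideal : Set CoordRing) with hKdef
  have h1 := (hn (2 * r) (by omega)).1
  rw [hilb_of_mem_locusD hZ (by omega)] at h1
  subst h1
  have h2 := hlink r (r - 1) (by omega)
  rw [finrank_formsIn_span_pair_self hf hg hf0 hg0 hfg (by omega), hZr] at h2
  have h3 := hlink (r - 1) r (by omega)
  rw [finrank_formsIn_span_pair_of_lt hf hg hf0 hg0 hfg (by omega) (by omega),
    finrank_formsIn_pred_eq_zero (by omega) hZr] at h3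
  -- Duality gives the value `n' = d_r - 1` in both degrees. Hence `K` contains one form of degree
  -- `r - 1` and an `(r + 2)`-dimensional space of forms of degree `r`.
  have hK1 : hilb K (r - 1) = hilb K r := by omega
  have h4 := two_mul_tri r
  have h5 := two_mul_tri (r + 1)
  have h6 := hilb_add_finrank K (r - 1)
  have h7 := hilb_add_finrank K r
  rw [show r - 1 + 1 = r by omega] at h6
  rw [tri_succ] at h7 hnn
  have hn' : n' + 1 = tri r := by nlinarith
  have hd1 : Module.finrank ℂ (formsIn K (r - 1)) = 1 := by omega
  have hd2 : Module.finrank ℂ (formsIn K r) = r + 2 := by omega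
  obtain ⟨h, hhK, hh, hh0⟩ := exists_mem_formsIn_ne_zero (I := K) (t := r - 1) (by omega)
  have hmul : ∀ q ∈ K, q.IsHomogeneous (r - 1) → ∃ c : ℂ, q = C c * h := by
    intro q hq hqh
    have hne : (⟨⟨h, hh⟩, hhK⟩ : formsIn K (r - 1)) ≠ 0 := fun h0 =>
      hh0 (congrArg (fun x : formsIn K (r - 1) => (x.1 : CoordRing)) h0)
    obtain ⟨c, hc⟩ := (finrank_eq_one_iff_of_nonzero' (K := ℂ) (V := formsIn K (r - 1)) _ hne).1 hd1 ⟨⟨q, hqh⟩, hq⟩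
    refine ⟨c, ?_⟩
    rw [← smul_eq_C_mul]
    exact (congrArg (fun x : formsIn K (r - 1) => (x.1 : CoordRing)) hc).symm
  -- Multiples of `h` in degree `r` have dimension only `3`, less than `r + 2`.
  obtain ⟨f', hf'K, hf', hhf'⟩ : ∃ f' ∈ K, f'.IsHomogeneous r ∧ ¬ h ∣ f' := by
    by_contra! hcon
    have hle : formsIn K r ≤ formsIn (Ideal.span {h}) r := fun q hq =>
      Ideal.mem_span_singleton.2 (hcon q hq q.2)
    have := Submodule.finrank_mono hle
    rw [hd2, finrank_formsIn_span_singleton hh hh0, show r + 1 - (r - 1) = 2 by omega,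
      show tri 2 = 3 from rfl] at this
    omega
  have hfK : f ∈ K := le_colon_of_mem _ (Ideal.subset_span (by simp))
  have hgK : g ∈ K := le_colon_of_mem _ (Ideal.subset_span (by simp))
  refine ⟨K, f, f', g, hK, hKs, hK1, hf, hf', hg, hf0, hg0, hfg, hKK.symm, ?_⟩
  have hdvdfin : {s : ℂ | h ∣ f + C s * f'}.Finite := by
    refine Set.Subsingleton.finite fun s hs t ht => ?_
    by_contra hne
    have h1 := dvd_sub (show h ∣ _ from hs) (show h ∣ _ from ht)
    have e : f + C s * f' - (f + C t * f') = C (s - t) * f' := by rw [C_sub]; ring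
    rw [e] at h1
    have hu : IsUnit (C (s - t) : CoordRing) := (IsUnit.mk0 _ (sub_ne_zero.2 hne)).map C
    exact hhf' ((hu.dvd_mul_left).1 h1)
  filter_upwards [(finite_not_isRelPrime (f' := f') hg0 hfg).compl_mem_cofinite,
    hdvdfin.compl_mem_cofinite] with s hs1 hs2
  have hs1 : IsRelPrime (f + C s * f') g := not_not.1 hs1
  have hs0 : f + C s * f' ≠ 0 := by
    intro h0
    rw [h0] at hs1
    exact not_isUnit_of_isHomogeneous hg (by omega) (isRelPrime_zero_left.1 hs1)
  refine ⟨hs0, hs1, exists_linked_hilbPoints hr hK hKs hK1 hd1 (hf.add ?_) hg hs0 hg0 hs1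
    (K.add_mem hfK (K.mul_mem_left _ hf'K)) hgK ?_⟩
  · have := (isHomogeneous_C (Fin 3) s).mul hf'
    rwa [zero_add] at this
  · intro q hq hqh hqf
    obtain ⟨c, rfl⟩ := hmul q hq hqh
    exact hs2 (dvd_of_mul_left_dvd hqf)

/-! ### Regular families of vectors and linear maps -/

section Families

variable {B : Type*} {A : Subalgebra ℂ (B → ℂ)}
variable {E F G : Type*} [AddCommGroup E] [Module ℂ E] [AddCommGroup F] [Module ℂ F]
  [AddCommGroup G] [Module ℂ G]

/-- A family of vectors whose coordinates are regular functions on the base. -/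
def Reg (A : Subalgebra ℂ (B → ℂ)) (v : B → E) : Prop :=
  ∀ ξ : Module.Dual ℂ E, (fun x => ξ (v x)) ∈ A

lemma Reg.map {v : B → E} (hv : Reg A v) (L : E →ₗ[ℂ] F) : Reg A fun x => L (v x) :=
  fun ξ => hv (ξ ∘ₗ L)

lemma reg_const (v : E) : Reg A fun _ => v := fun ξ => A.algebraMap_mem (ξ v)

lemma Reg.add {v w : B → E} (hv : Reg A v) (hw : Reg A w) : Reg A fun x => v x + w x := fun ξ => by
  simp only [map_add]; exact A.add_mem (hv ξ) (hw ξ)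

lemma Reg.sub {v w : B → E} (hv : Reg A v) (hw : Reg A w) : Reg A fun x => v x - w x := fun ξ => by
  simp only [map_sub]; exact A.sub_mem (hv ξ) (hw ξ)

lemma Reg.sum {ι : Type*} (s : Finset ι) {v : ι → B → E} (hv : ∀ i ∈ s, Reg A (v i)) :
    Reg A fun x => ∑ i ∈ s, v i x := fun ξ => by
  have := A.sum_mem (t := s) fun i hi => hv i hi ξ
  convert this using 1
  funext x
  simp

lemma Reg.smul {c : B → ℂ} {v : B → E} (hc : c ∈ A) (hv : Reg A v) : Reg A fun x => c x • v x :=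
  fun ξ => by simp only [map_smul]; exact A.mul_mem hc (hv ξ)

lemma Reg.apply {L : B → E →ₗ[ℂ] F} (hL : Reg A L) (v : E) : Reg A fun x => L x v :=
  hL.map (LinearMap.applyₗ v)

lemma Reg.apply₂ [FiniteDimensional ℂ E] {L : B → E →ₗ[ℂ] F} (hL : Reg A L) {v : B → E}
    (hv : Reg A v) : Reg A fun x => L x (v x) := by
  have b := Module.finBasis ℂ E
  have h : (fun x => L x (v x)) = fun x => ∑ i, b.coord i (v x) • L x (b i) := by
    funext x
    calc L x (v x) = L x (∑ i, b.repr (v x) i • b i) := by rw [b.sum_repr]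
      _ = _ := by rw [map_sum]; simp only [map_smul, Module.Basis.coord_apply]
  rw [h]
  exact Reg.sum _ fun i _ => Reg.smul (hv (b.coord i)) (hL.apply _)

lemma reg_hom [FiniteDimensional ℂ E] {L : B → E →ₗ[ℂ] F} (h : ∀ v, Reg A fun x => L x v) :
    Reg A L := by
  have b := Module.finBasis ℂ E
  have : L = fun x => ∑ i, LinearMap.smulRightₗ (b.coord i) (L x (b i)) := by
    funext x
    apply b.ext
    intro j
    simp [Finsupp.single_apply]
  rw [this]
  exact Reg.sum _ fun i _ => (h (b i)).map _

lemma reg_pi {n : ℕ} {v : B → Fin n → ℂ} (h : ∀ i, (fun x => v x i) ∈ A) : Reg A v := by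
  have : v = fun x => ∑ i, v x i • (Pi.single i 1 : Fin n → ℂ) := by
    funext x
    exact (pi_eq_sum_univ' (v x)).trans (by simp)
  rw [this]
  exact Reg.sum _ fun i _ => Reg.smul (h i) (reg_const _)

lemma Reg.comp [FiniteDimensional ℂ E] [FiniteDimensional ℂ F] {L : B → F →ₗ[ℂ] G}
    {M : B → E →ₗ[ℂ] F} (hL : Reg A L) (hM : Reg A M) : Reg A fun x => L x ∘ₗ M x :=
  reg_hom fun v => hL.apply₂ (hM.apply v)

/-- Evaluation of a regular function. -/
def evalAt (A : Subalgebra ℂ (B → ℂ)) (x : B) : A →+* ℂ :=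
  (Pi.evalRingHom (fun _ : B => ℂ) x).comp A.val.toRingHom

lemma exists_adjugate [FiniteDimensional ℂ E] {T : B → E →ₗ[ℂ] E} (hT : Reg A T) {x₀ : B}
    (h₀ : T x₀ = LinearMap.id) : ∃ δ ∈ A, ∃ S : B → E →ₗ[ℂ] E, Reg A S ∧ δ x₀ = 1 ∧
      ∀ x v, T x (S x v) = δ x • v ∧ S x (T x v) = δ x • v := by
  classical
  have b := Module.finBasis ℂ E
  let N : Matrix (Fin (Module.finrank ℂ E)) (Fin (Module.finrank ℂ E)) A :=
    fun i j => ⟨fun x => LinearMap.toMatrix b b (T x) i j, by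
      simp only [LinearMap.toMatrix_apply]
      exact hT.apply (b j) (b.coord i)⟩
  have hN : ∀ x, (evalAt A x).mapMatrix N = LinearMap.toMatrix b b (T x) := fun x => rfl
  have hdet : ∀ x, (N.det : B → ℂ) x = (LinearMap.toMatrix b b (T x)).det := fun x => by
    rw [← hN x, ← RingHom.map_det]; rfl
  refine ⟨N.det, N.det.2, fun x => Matrix.toLin b b ((evalAt A x).mapMatrix N.adjugate), ?_, ?_, ?_⟩
  · refine reg_hom fun v => ?_
    have : (fun x => Matrix.toLin b b ((evalAt A x).mapMatrix N.adjugate) v) =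
        fun x => ∑ i, (∑ j, (N.adjugate i j : B → ℂ) x * b.repr v j) • b i := by
      funext x
      rw [Matrix.toLin_apply]; rfl
    rw [this]
    refine Reg.sum _ fun i _ => Reg.smul ?_ (reg_const _)
    have h2 := A.sum_mem (t := Finset.univ) fun j _ =>
      A.mul_mem (N.adjugate i j).2 (A.algebraMap_mem (b.repr v j))
    convert h2 using 1
    funext x
    simp
  · rw [hdet, h₀, LinearMap.toMatrix_id, Matrix.det_one]
  · intro x v
    have hTx : T x = Matrix.toLin b b (LinearMap.toMatrix b b (T x)) :=
      (Matrix.toLin_toMatrix _ _ _).symm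
    have h1 : (evalAt A x).mapMatrix N.adjugate = (LinearMap.toMatrix b b (T x)).adjugate := by
      rw [← hN x, RingHom.map_adjugate]
    constructor
    · beta_reduce
      rw [h1]
      conv_lhs => rw [hTx]
      rw [← Matrix.toLin_mul_apply, LinearMap.toMatrix_toLin, Matrix.mul_adjugate, hdet]
      simp
    · beta_reduce
      rw [h1]
      conv_lhs => rw [hTx]
      rw [← Matrix.toLin_mul_apply, LinearMap.toMatrix_toLin, Matrix.adjugate_mul, hdet]
      simp

/-- Injectivity is an open condition in a regular family of linear maps. -/
lemma exists_open_injective [FiniteDimensional ℂ E] [FiniteDimensional ℂ F] {L : B → E →ₗ[ℂ] F}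
    (hL : Reg A L) {x₀ : B} (h₀ : Function.Injective (L x₀)) :
    ∃ δ ∈ A, δ x₀ ≠ 0 ∧ ∀ x, δ x ≠ 0 → Function.Injective (L x) := by
  -- With a fixed left inverse `P` of `L x₀`, the determinant of `P ∘ L x` is regular and nonzero at
  -- `x₀`.
  obtain ⟨P, hP⟩ := LinearMap.exists_leftInverse_of_injective (L x₀) (LinearMap.ker_eq_bot.2 h₀)
  obtain ⟨δ, hδ, S, -, hδ₀, hS⟩ := exists_adjugate (T := fun x => P ∘ₗ L x)
    ((reg_const P).comp hL) hP
  refine ⟨δ, hδ, by rw [hδ₀]; exact one_ne_zero, fun x hx => ?_⟩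
  rw [injective_iff_map_eq_zero]
  intro v hv
  have := (hS x v).2
  rw [LinearMap.comp_apply, hv, map_zero, map_zero] at this
  exact (smul_eq_zero.1 this.symm).resolve_left hx

/-- Vectors in the kernel of one surjective member of a regular family of linear maps extend to a
regular family of vectors in the kernels. -/
lemma exists_kernel_family [FiniteDimensional ℂ E] [FiniteDimensional ℂ F] {L : B → E →ₗ[ℂ] F}
    (hL : Reg A L) {x₀ : B} (h₀ : Function.Surjective (L x₀)) :
    ∃ δ ∈ A, δ x₀ ≠ 0 ∧ (∀ x, δ x ≠ 0 → Function.Surjective (L x)) ∧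
      ∃ k : B → E →ₗ[ℂ] E, Reg A k ∧ (∀ x v, L x (k x v) = 0) ∧
        ∀ v, L x₀ v = 0 → k x₀ v = v := by
  obtain ⟨Q, hQ⟩ := LinearMap.exists_rightInverse_of_surjective (L x₀) (LinearMap.range_eq_top.2 h₀)
  obtain ⟨δ, hδ, S, hSr, hδ₀, hS⟩ := exists_adjugate (T := fun x => L x ∘ₗ Q)
    (hL.comp (reg_const Q)) hQ
  refine ⟨δ, hδ, by rw [hδ₀]; exact one_ne_zero, fun x hx w => ⟨Q (S x ((δ x)⁻¹ • w)), ?_⟩,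
    -- The projection onto the kernel, multiplied by the determinant `δ`: the adjugate `S` replaces
    -- an inverse of `L ∘ Q`, so no division is needed.
    fun x => δ x • LinearMap.id - Q ∘ₗ S x ∘ₗ L x, ?_, fun x v => ?_, fun v hv => ?_⟩
  · have := (hS x ((δ x)⁻¹ • w)).1
    rw [smul_inv_smul₀ hx] at this
    exact this
  · exact (Reg.smul hδ (reg_const _)).sub ((reg_const Q).comp (hSr.comp hL))
  · have := (hS x (L x v)).1
    simp only [LinearMap.comp_apply] at this
    simp [this]
  · simp [hv, hδ₀]

/-- The images of a regular family of linear maps of constant rank are the kernels of another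
regular family. -/
lemma exists_cokernel_family [FiniteDimensional ℂ E] [FiniteDimensional ℂ F] {L : B → E →ₗ[ℂ] F}
    (hL : Reg A L) (x₀ : B) : ∃ δ ∈ A, δ x₀ ≠ 0 ∧ ∃ q : B → F →ₗ[ℂ] F, Reg A q ∧
      ∀ x, δ x ≠ 0 → Module.finrank ℂ (LinearMap.range (L x)) ≤
        Module.finrank ℂ (LinearMap.range (L x₀)) → LinearMap.ker (q x) = LinearMap.range (L x) := by
  obtain ⟨P, hP⟩ := LinearMap.exists_leftInverse_of_injective (LinearMap.range (L x₀)).subtype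
    (Submodule.ker_subtype _)
  obtain ⟨Q, hQ⟩ := LinearMap.exists_rightInverse_of_surjective (L x₀).rangeRestrict
    (LinearMap.range_rangeRestrict _)
  have hT₀ : P ∘ₗ L x₀ ∘ₗ Q = LinearMap.id := by
    rw [← hP]
    ext v
    simp only [LinearMap.comp_apply]
    have := congrArg Subtype.val (LinearMap.congr_fun hQ v)
    simp only [LinearMap.comp_apply, LinearMap.id_apply] at this
    change ((P (L x₀ (Q v)) : LinearMap.range (L x₀)) : F) = P (v : F)
    rw [show L x₀ (Q v) = (v : F) from this]
  obtain ⟨δ, hδ, S, hSr, hδ₀, hS⟩ := exists_adjugate (T := fun x => P ∘ₗ L x ∘ₗ Q)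
    ((reg_const P).comp (hL.comp (reg_const Q))) hT₀
  refine ⟨δ, hδ, by rw [hδ₀]; exact one_ne_zero,
    -- Again a cleared projection, now with kernel the image of `L x`. The rank bound ensures that
    -- `L x ∘ Q` already has the full image.
    fun x => δ x • LinearMap.id - L x ∘ₗ Q ∘ₗ S x ∘ₗ P, ?_, fun x hx hrank => ?_⟩
  · exact (Reg.smul hδ (reg_const _)).sub (hL.comp ((reg_const Q).comp (hSr.comp (reg_const P))))
  have hq : ∀ w, (δ x • LinearMap.id - L x ∘ₗ Q ∘ₗ S x ∘ₗ P : F →ₗ[ℂ] F) w = δ x • w - L x (Q (S x (P w))) :=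
    fun w => rfl
  have hinj : Function.Injective (L x ∘ₗ Q) := by
    rw [injective_iff_map_eq_zero]
    intro v hv
    have := (hS x v).2
    simp only [LinearMap.comp_apply] at this hv
    rw [hv, map_zero, map_zero] at this
    exact (smul_eq_zero.1 this.symm).resolve_left hx
  have hrange : LinearMap.range (L x ∘ₗ Q) = LinearMap.range (L x) := by
    refine Submodule.eq_of_le_of_finrank_le (LinearMap.range_comp_le_range _ _) ?_
    rwa [LinearMap.finrank_range_of_inj hinj]
  apply le_antisymm
  · intro w hw
    rw [LinearMap.mem_ker, hq, sub_eq_zero] at hw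
    refine ⟨(δ x)⁻¹ • Q (S x (P w)), ?_⟩
    rw [map_smul, ← hw, inv_smul_smul₀ hx]
  · rw [← hrange]
    rintro _ ⟨v, rfl⟩
    have := (hS x v).2
    simp only [LinearMap.comp_apply] at this
    rw [LinearMap.mem_ker, hq, LinearMap.comp_apply, this, map_smul, map_smul, sub_self]

end Families

/-! ### The Zariski topology through frames -/

/-- The polynomial functions on the affine line. -/
def polyFun : Subalgebra ℂ (ℂ → ℂ) := (Polynomial.aeval (id : ℂ → ℂ)).range

lemma id_mem_polyFun : (fun s : ℂ => s) ∈ polyFun := ⟨Polynomial.X, Polynomial.aeval_X _⟩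

lemma eventually_ne_zero_of_mem_polyFun {F : ℂ → ℂ} (hF : F ∈ polyFun) {s₀ : ℂ} (h₀ : F s₀ ≠ 0) :
    ∀ᶠ s in Filter.cofinite, F s ≠ 0 := by
  obtain ⟨P, rfl⟩ := hF
  have heval : ∀ s, Polynomial.aeval (id : ℂ → ℂ) P s = P.eval s := fun s => by
    have := Polynomial.aeval_algHom_apply (Pi.evalAlgHom ℂ (fun _ : ℂ => ℂ) s) (id : ℂ → ℂ) P
    rw [← Polynomial.coe_aeval_eq_eval]; exact this.symm
  have hP : P ≠ 0 := by rintro rfl; simp at h₀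
  refine (P.rootSet_finite ℂ).subset fun s hs => ?_
  rw [Polynomial.mem_rootSet]
  refine ⟨hP, ?_⟩
  have : Polynomial.aeval (id : ℂ → ℂ) P s = 0 := not_not.1 hs
  rw [heval] at this
  simpa using this

/-- The coordinates on the space of linear maps `Forms t → ℂⁿ`. -/
def homCoord (t n : ℕ) (e : Fin n × {m : Fin 3 →₀ ℕ // m.degree = t})
    (φ : Forms t →ₗ[ℂ] (Fin n → ℂ)) : ℂ :=
  φ ⟨monomial e.2.1 1, isHomogeneous_monomial 1 e.2.2⟩ e.1

/-- The polynomial functions on the space of linear maps `Forms t → ℂⁿ`. -/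
def homFun (t n : ℕ) : Subalgebra ℂ ((Forms t →ₗ[ℂ] (Fin n → ℂ)) → ℂ) :=
  (aeval (homCoord t n)).range

lemma aeval_homCoord_apply {t n : ℕ} (P : MvPolynomial _ ℂ) (φ : Forms t →ₗ[ℂ] (Fin n → ℂ)) :
    aeval (homCoord t n) P φ = aeval (fun e => homCoord t n e φ) P := by
  have := comp_aeval_apply (homCoord t n) (Pi.evalAlgHom ℂ (fun _ => ℂ) φ) P
  exact this

lemma isOpen_ne_zero_of_mem_homFun {t n : ℕ} {F : (Forms t →ₗ[ℂ] (Fin n → ℂ)) → ℂ}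
    (hF : F ∈ homFun t n) : @IsOpen _ (zariskiHom t n) {φ | F φ ≠ 0} := by
  obtain ⟨P, rfl⟩ := hF
  rw [isOpen_induced_iff]
  refine ⟨PrimeSpectrum.basicOpen P, PrimeSpectrum.isOpen_basicOpen, ?_⟩
  ext φ
  change P ∉ vanishingIdeal ℂ {_} ↔ aeval (homCoord t n) P φ ≠ 0
  rw [aeval_homCoord_apply, mem_vanishingIdeal_singleton_iff]
  rfl

lemma exists_mem_homFun_of_isOpen {t n : ℕ} {O : Set (Forms t →ₗ[ℂ] (Fin n → ℂ))}
    (hO : @IsOpen _ (zariskiHom t n) O) {φ₀ : Forms t →ₗ[ℂ] (Fin n → ℂ)} (h₀ : φ₀ ∈ O) :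
    ∃ F ∈ homFun t n, F φ₀ ≠ 0 ∧ ∀ φ, F φ ≠ 0 → φ ∈ O := by
  rw [isOpen_induced_iff] at hO
  obtain ⟨O', hO', rfl⟩ := hO
  obtain ⟨_, ⟨P, rfl⟩, hP, hle⟩ :=
    PrimeSpectrum.isTopologicalBasis_basic_opens.exists_subset_of_mem_open h₀ hO'
  have key : ∀ φ, aeval (homCoord t n) P φ ≠ 0 ↔
      pointToPoint (k := ℂ) (K := ℂ) (fun e => homCoord t n e φ) ∈ PrimeSpectrum.basicOpen P := by
    intro φ
    change _ ↔ P ∉ vanishingIdeal ℂ {_}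
    rw [aeval_homCoord_apply, mem_vanishingIdeal_singleton_iff]
  exact ⟨_, ⟨P, rfl⟩, (key φ₀).2 hP, fun φ hφ => hle ((key φ).1 hφ)⟩

lemma reg_id_homFun (t n : ℕ) : Reg (homFun t n) fun φ : Forms t →ₗ[ℂ] (Fin n → ℂ) => φ := by
  refine reg_hom fun v => reg_pi fun i => ?_
  have hv : v = ∑ m : v.1.support, coeff m.1 v.1 • (⟨monomial m.1 1,
      isHomogeneous_monomial 1 (by
        by_contra h
        exact mem_support_iff.1 m.2 (IsHomogeneous.coeff_eq_zero v.2 h))⟩ : Forms t) := by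
    apply Subtype.ext
    conv_lhs => rw [v.1.as_sum]
    rw [AddSubmonoidClass.coe_finsetSum, ← Finset.sum_coe_sort]
    refine Finset.sum_congr rfl fun m _ => ?_
    simp [smul_monomial]
  have : (fun φ : Forms t →ₗ[ℂ] (Fin n → ℂ) => φ v i) = ∑ m : v.1.support, coeff m.1 v.1 •
      homCoord t n (i, ⟨m.1, by
        by_contra h
        exact mem_support_iff.1 m.2 (IsHomogeneous.coeff_eq_zero v.2 h)⟩) := by
    funext φ
    conv_lhs => rw [hv]
    rw [map_sum, Finset.sum_apply, Finset.sum_apply]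
    refine Finset.sum_congr rfl fun m _ => ?_
    rw [map_smul]; rfl
  rw [this]
  exact Subalgebra.sum_mem _ fun m _ => Subalgebra.smul_mem _
    ((AlgHom.mem_range _).2 ⟨X _, aeval_X _ _⟩) _

lemma comp_mem_of_mem_homFun {B : Type*} {A : Subalgebra ℂ (B → ℂ)} {t n : ℕ}
    {Φ : B → Forms t →ₗ[ℂ] (Fin n → ℂ)} (hΦ : Reg A Φ)
    {F : (Forms t →ₗ[ℂ] (Fin n → ℂ)) → ℂ} (hF : F ∈ homFun t n) : (fun x => F (Φ x)) ∈ A := by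
  obtain ⟨P, rfl⟩ := hF
  have hc : ∀ e, (fun x => homCoord t n e (Φ x)) ∈ A := fun e =>
    hΦ.apply _ (LinearMap.proj e.1)
  have : (fun x => aeval (homCoord t n) P (Φ x)) = aeval (fun e => fun x => homCoord t n e (Φ x)) P := by
    funext x
    rw [aeval_homCoord_apply]
    exact (comp_aeval_apply (fun e => fun x => homCoord t n e (Φ x))
      (Pi.evalAlgHom ℂ (fun _ => ℂ) x) P).symm
  change (fun x => aeval (homCoord t n) P (Φ x)) ∈ A
  rw [this]
  clear this
  induction P using MvPolynomial.induction_on with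
  | C a => rw [aeval_C]; exact A.algebraMap_mem a
  | add p q hp hq => rw [map_add]; exact A.add_mem hp hq
  | mul_X p e hp => rw [map_mul, aeval_X]; exact A.mul_mem hp (hc e)

/-- The topology is a quotient topology, so openness is tested upstairs, at every frame of every
member, with principal open sets as neighbourhoods. -/
lemma isOpen_of_forall_frame {n : ℕ} {U : Set (HilbPoints n)}
    (h : ∀ p : Frame n, p.1.1 ∈ U → ∃ F ∈ homFun n n, F p.1.2 ≠ 0 ∧
      ∀ q : Frame n, F q.1.2 ≠ 0 → q.1.1 ∈ U) : IsOpen U := by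
  rw [isOpen_coinduced]
  refine (@isOpen_iff_forall_mem_open (Frame n) (TopologicalSpace.induced
    (fun p : Frame n => p.1.2) (zariskiHom n n)) _).2 fun p hp => ?_
  obtain ⟨F, hF, hFp, hFU⟩ := h p hp
  refine ⟨{q | F q.1.2 ≠ 0}, fun q hq => hFU q hq, ?_, hFp⟩
  refine (@isOpen_induced_iff _ _ (zariskiHom n n) _ _).2 ?_
  exact ⟨_, isOpen_ne_zero_of_mem_homFun hF, rfl⟩

lemma exists_homFun_of_isOpen {n : ℕ} {U : Set (HilbPoints n)} (hU : IsOpen U) {p : Frame n}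
    (hp : p.1.1 ∈ U) : ∃ F ∈ homFun n n, F p.1.2 ≠ 0 ∧
      ∀ q : Frame n, F q.1.2 ≠ 0 → q.1.1 ∈ U := by
  rw [isOpen_coinduced] at hU
  obtain ⟨O, hO, hOU⟩ := (@isOpen_induced_iff _ _ (zariskiHom n n) _ _).1 hU
  have hpO : p.1.2 ∈ O := by
    have : p ∈ (fun p : Frame n => p.1.2) ⁻¹' O := by rw [hOU]; exact hp
    exact this
  obtain ⟨F, hF, hFp, hFO⟩ := exists_mem_homFun_of_isOpen hO hpO
  refine ⟨F, hF, hFp, fun q hq => ?_⟩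
  have : q ∈ (fun p : Frame n => p.1.2) ⁻¹' O := hFO _ hq
  rw [hOU] at this
  exact this

/-- A surjection onto `ℂⁿ` that kills the forms of an ideal of colength at most `n` in the given
degree has no other kernel, and the colength is `n`. -/
lemma ker_eq_formsIn {I : Ideal CoordRing} {t n : ℕ} {φ : Forms t →ₗ[ℂ] (Fin n → ℂ)}
    (hφ : Function.Surjective φ) (hle : formsIn I t ≤ LinearMap.ker φ) (hI : hilb I t ≤ n) :
    LinearMap.ker φ = formsIn I t ∧ hilb I t = n := by
  have h1 := LinearMap.finrank_range_add_finrank_ker φ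
  rw [LinearMap.range_eq_top.2 hφ, finrank_top, Module.finrank_fin_fun, finrank_forms] at h1
  have h2 := hilb_add_finrank I t
  have h3 := Submodule.finrank_mono hle
  exact ⟨(Submodule.eq_of_le_of_finrank_le hle (by omega)).symm, by omega⟩

lemma surjective_of_ker_eq_formsIn {I : Ideal CoordRing} {t n : ℕ} {φ : Forms t →ₗ[ℂ] (Fin n → ℂ)}
    (hker : LinearMap.ker φ = formsIn I t) (hI : hilb I t = n) : Function.Surjective φ := by
  rw [← LinearMap.range_eq_top]
  apply Submodule.eq_top_of_finrank_eq
  have h1 := LinearMap.finrank_range_add_finrank_ker φ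
  have h2 := hilb_add_finrank I t
  rw [hker, finrank_forms] at h1
  rw [Module.finrank_fin_fun]
  omega

/-! ### Openness of the good locus -/

/-- The map `(a, b) ↦ a f + b g` on pairs of forms. -/
def combine {d e u v c : ℕ} (hu : d + u = c) (hv : e + v = c) :
    Forms d × Forms e →ₗ[ℂ] Forms u × Forms v →ₗ[ℂ] Forms c :=
  (LinearMap.compl₁₂ (mulForm hu) (LinearMap.fst ℂ (Forms d) (Forms e))
    (LinearMap.fst ℂ (Forms u) (Forms v))) +
  (LinearMap.compl₁₂ (mulForm hv) (LinearMap.snd ℂ (Forms d) (Forms e))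
    (LinearMap.snd ℂ (Forms u) (Forms v)))

@[simp] lemma coe_combine {d e u v c : ℕ} (hu : d + u = c) (hv : e + v = c)
    (x : Forms d × Forms e) (y : Forms u × Forms v) :
    (combine hu hv x y : CoordRing) = x.1 * y.1 + x.2 * y.2 := rfl

lemma range_combine {d e u v c : ℕ} (hu : d + u = c) (hv : e + v = c) (f : Forms d) (g : Forms e) :
    LinearMap.range (combine hu hv (f, g)) = formsIn (Ideal.span {(f : CoordRing), (g : CoordRing)}) c := by
  apply le_antisymm
  · rintro _ ⟨y, rfl⟩
    exact Ideal.mem_span_pair.2 ⟨y.1, y.2, by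
      change _ = (combine hu hv (f, g) y : CoordRing)
      rw [coe_combine]; ring⟩
  · intro p hp
    obtain ⟨a, b, hab⟩ := Ideal.mem_span_pair.1 hp
    refine ⟨(⟨homogeneousComponent u a, homogeneousComponent_isHomogeneous _ _⟩,
      ⟨homogeneousComponent v b, homogeneousComponent_isHomogeneous _ _⟩), Subtype.ext ?_⟩
    have h1 : homogeneousComponent c (f * a : CoordRing) = f * homogeneousComponent u a := by
      rw [← hu, homogeneousComponent_mul_add f.2]
    have h2 : homogeneousComponent c (g * b : CoordRing) = g * homogeneousComponent v b := by
      rw [← hv, homogeneousComponent_mul_add g.2]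
    have hab' : f * a + g * b = (p : CoordRing) := by
      rw [mul_comm _ a, mul_comm _ b]; exact hab
    rw [coe_combine, ← homogeneousComponent_eq_self p.2, ← hab', map_add, h1, h2]

/-- A relation is a multiple of `(g, -f)`, whose entries have degree `r + 1`; coefficients of degree
`r` leave only the zero multiple. -/
lemma combine_injective {r c : ℕ} (hc : r + 1 + r = c) {f g : Forms (r + 1)}
    (hf0 : (f : CoordRing) ≠ 0) (hfg : IsRelPrime (f : CoordRing) g) :
    Function.Injective (combine hc hc (f, g)) := by
  rw [injective_iff_map_eq_zero]
  rintro ⟨a, b⟩ hab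
  have h0 : (a : CoordRing) * f + b * g = 0 := by
    have := congrArg Subtype.val hab
    rw [coe_combine] at this
    rw [mul_comm _ (f : CoordRing), mul_comm _ (g : CoordRing)]
    exact this
  obtain ⟨k, hk1, hk2⟩ := exists_syzygy hf0 hfg h0
  have hk : k = 0 := by
    by_contra hk
    have hb : ((f : CoordRing) * k).IsHomogeneous r := by
      have : (f : CoordRing) * k = -b := by rw [hk2]; ring
      rw [this]; exact b.2.neg
    obtain ⟨x, hx, -⟩ := isHomogeneous_of_mul f.2 hf0 hk hb
    omega
  rw [hk] at hk1 hk2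
  exact Prod.ext (Subtype.ext (by simpa using hk1)) (Subtype.ext (by simpa using hk2))

lemma isRelPrime_of_combine_injective {r c : ℕ} (hc : r + 1 + r = c) {f g : Forms (r + 1)}
    (h : Function.Injective (combine hc hc (f, g))) :
    (f : CoordRing) ≠ 0 ∧ (g : CoordRing) ≠ 0 ∧ IsRelPrime (f : CoordRing) g := by
  have key : ∀ a b : CoordRing, a.IsHomogeneous r → b.IsHomogeneous r →
      (f : CoordRing) * a + g * b = 0 → a = 0 ∧ b = 0 := by
    intro a b ha hb hab
    have h1 : combine hc hc (f, g) (⟨a, ha⟩, ⟨b, hb⟩) = combine hc hc (f, g) 0 := by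
      rw [map_zero]; exact Subtype.ext hab
    have h2 := h h1
    exact ⟨congrArg Subtype.val (congrArg Prod.fst h2), congrArg Subtype.val (congrArg Prod.snd h2)⟩
  have hX : (X 0 ^ r : CoordRing).IsHomogeneous r := isHomogeneous_X_pow 0 r
  have hX0 : (X 0 ^ r : CoordRing) ≠ 0 := pow_ne_zero _ (X_ne_zero 0)
  have hf0 : (f : CoordRing) ≠ 0 := fun h0 =>
    hX0 (key _ 0 hX (isHomogeneous_zero _ _ _) (by rw [h0]; ring)).1
  have hg0 : (g : CoordRing) ≠ 0 := fun h0 =>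
    hX0 (key 0 _ (isHomogeneous_zero _ _ _) hX (by rw [h0]; ring)).2
  refine ⟨hf0, hg0, fun d hdf hdg => ?_⟩
  by_contra hu
  obtain ⟨p, hp, hpd⟩ := WfDvdMonoid.exists_irreducible_factor hu (ne_zero_of_dvd_ne_zero hf0 hdf)
  obtain ⟨e, he1, her, hpe⟩ := exists_isHomogeneous_of_irreducible_dvd f.2 hf0 hp (hpd.trans hdf)
  obtain ⟨f₁, hf₁⟩ := hpd.trans hdf
  obtain ⟨g₁, hg₁⟩ := hpd.trans hdg
  have her' : e + (r + 1 - e) = r + 1 := by omega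
  have hf₁h : f₁.IsHomogeneous (r + 1 - e) := isHomogeneous_of_mul_add hpe hp.ne_zero (by
    rw [← hf₁, her']; exact f.2)
  have hg₁h : g₁.IsHomogeneous (r + 1 - e) := isHomogeneous_of_mul_add hpe hp.ne_zero (by
    rw [← hg₁, her']; exact g.2)
  -- A common factor of degree `e` gives the relation `(g₁, -f₁)` in degree `r + 1 - e`; a power of
  -- `x₀` raises it to degree `r`.
  have hXe : (X 0 ^ (e - 1) : CoordRing).IsHomogeneous (e - 1) := isHomogeneous_X_pow 0 _
  have hsum : e - 1 + (r + 1 - e) = r := by omega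
  have := (key (X 0 ^ (e - 1) * g₁) (-(X 0 ^ (e - 1) * f₁)) (hsum ▸ hXe.mul hg₁h)
    (hsum ▸ (hXe.mul hf₁h).neg) (by rw [hf₁, hg₁]; ring)).1
  have hg₁0 := (mul_eq_zero.1 this).resolve_left (pow_ne_zero _ (X_ne_zero 0))
  exact hg0 (by rw [hg₁, hg₁0, mul_zero])

lemma le_tri_succ (r : ℕ) : r + 1 ≤ tri (r + 1) := by rw [tri_succ]; omega

lemma pow_mem_of_nzd {I : Ideal CoordRing} {l : CoordRing} (hnz : ∀ p, l * p ∈ I → p ∈ I) (k : ℕ)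
    {p : CoordRing} (h : l ^ k * p ∈ I) : p ∈ I := by
  induction k with
  | zero => simpa using h
  | succ k ih => exact ih (hnz _ (by rwa [← mul_assoc, ← pow_succ']))

/-- A frame lives in degree `d_{r+1}`. Composing it with multiplication by a power of `l` yields a
regular family on forms of degree `r + 1`; where this is surjective, `f` and `g` extend to forms in
the nearby ideals, and coprimality persists as injectivity of `combine`. -/
lemma isOpen_goodLocus (r : ℕ) : IsOpen (goodLocus r) := by
  refine isOpen_of_forall_frame ?_
  rintro ⟨⟨Z, φ₀⟩, hsurj, hker⟩ ⟨hZ, f, hfZ, g, hgZ, hf, hg, hf0, hg0, hfg⟩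
  dsimp only at hsurj hker hZ hfZ hgZ
  obtain ⟨l, hl, hnz, -⟩ := exists_linear_nzd Z.isSat Z.isSat
  have hN := le_tri_succ r
  have hk : (tri (r + 1) - (r + 1)) + (r + 1) = tri (r + 1) := by omega
  set k := tri (r + 1) - (r + 1)
  have hlk : (l ^ k).IsHomogeneous k := by simpa using hl.pow k
  set μ : Forms (r + 1) →ₗ[ℂ] Forms (tri (r + 1)) := mulForm hk ⟨l ^ k, hlk⟩ with hμ
  have hμI : ∀ W : HilbPoints (tri (r + 1)), ∀ φ : Forms (tri (r + 1)) →ₗ[ℂ] (Fin (tri (r + 1)) → ℂ),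
      LinearMap.ker φ = formsIn W.ideal (tri (r + 1)) →
      formsIn W.ideal (r + 1) ≤ LinearMap.ker (φ ∘ₗ μ) := by
    intro W φ hφ q hq
    have : μ q ∈ LinearMap.ker φ := by
      rw [hφ]; exact W.ideal.mul_mem_left _ hq
    exact this
  have hker₀ : LinearMap.ker (φ₀ ∘ₗ μ) = formsIn Z.ideal (r + 1) := by
    refine le_antisymm (fun q hq => ?_) (hμI Z φ₀ hker)
    have : μ q ∈ LinearMap.ker φ₀ := hq
    rw [hker] at this
    exact pow_mem_of_nzd hnz k this
  have hreg : Reg (homFun (tri (r + 1)) (tri (r + 1)))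
      fun φ : Forms (tri (r + 1)) →ₗ[ℂ] (Fin (tri (r + 1)) → ℂ) => φ ∘ₗ μ :=
    (reg_id_homFun _ _).comp (reg_const μ)
  obtain ⟨δ, hδ, hδ₀, hδs, K, hK, hK0, hK1⟩ := exists_kernel_family hreg (x₀ := φ₀)
    (surjective_of_ker_eq_formsIn hker₀ hZ)
  set f' : Forms (r + 1) := ⟨f, hf⟩
  set g' : Forms (r + 1) := ⟨g, hg⟩
  have hKf : K φ₀ f' = f' := hK1 _ (by
    have : f' ∈ LinearMap.ker (φ₀ ∘ₗ μ) := by rw [hker₀]; exact hfZ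
    exact this)
  have hKg : K φ₀ g' = g' := hK1 _ (by
    have : g' ∈ LinearMap.ker (φ₀ ∘ₗ μ) := by rw [hker₀]; exact hgZ
    exact this)
  have hc : r + 1 + r = 2 * r + 1 := by ring
  have hpair : Reg (homFun (tri (r + 1)) (tri (r + 1))) fun φ => (K φ f', K φ g') := by
    have h1 := (hK.apply f').map (LinearMap.inl ℂ (Forms (r + 1)) (Forms (r + 1)))
    have h2 := (hK.apply g').map (LinearMap.inr ℂ (Forms (r + 1)) (Forms (r + 1)))
    simpa using h1.add h2
  obtain ⟨δ', hδ', hδ'₀, hδ'i⟩ := exists_open_injective (hpair.map (combine hc hc)) (x₀ := φ₀) (by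
    rw [hKf, hKg]; exact combine_injective hc hf0 hfg)
  refine ⟨δ * δ', Subalgebra.mul_mem _ hδ hδ', mul_ne_zero hδ₀ hδ'₀, ?_⟩
  rintro ⟨⟨W, φ⟩, hφs, hφk⟩ hne
  dsimp only at hφs hφk hne ⊢
  have hne1 : δ φ ≠ 0 := left_ne_zero_of_mul hne
  have hne2 : δ' φ ≠ 0 := right_ne_zero_of_mul hne
  -- The line `l` was chosen for `Z` and may meet `W`. Surjectivity together with the bound of the
  -- Hilbert function by the length still identifies the kernel.
  obtain ⟨hkW, hW⟩ := ker_eq_formsIn (hδs φ hne1) (hμI W φ hφk) (W.hilb_le _)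
  have hmem : ∀ q, (K φ q : CoordRing) ∈ W.ideal := fun q => by
    have : K φ q ∈ LinearMap.ker (φ ∘ₗ μ) := hK0 φ q
    rw [hkW] at this
    exact this
  obtain ⟨h1, h2, h3⟩ := isRelPrime_of_combine_injective hc (hδ'i φ hne2)
  exact ⟨hW, _, hmem f', _, hmem g', (K φ f').2, (K φ g').2, h1, h2, h3⟩

/-! ### Density of the good locus in the divisor -/

/-- Degree `r + 1` suffices to test the colon: higher forms of `K` are generated from it, and lower
ones are raised to it by all forms of the complementary degree, which saturation of `I` undoes. -/
lemma mem_colon_of_forall_forms {r : ℕ} {K : Ideal CoordRing} (hK : IsHomog K) (hKs : IsSat K)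
    (hK1 : hilb K r = hilb K (r + 1)) {I : Ideal CoordRing} (hI : IsSat I) {u : CoordRing}
    (h : ∀ w ∈ K, w.IsHomogeneous (r + 1) → u * w ∈ I) : u ∈ I.colon (K : Set CoordRing) := by
  have hhigh : ∀ k, ∀ w ∈ K, w.IsHomogeneous (r + 1 + k) → u * w ∈ I := by
    intro k
    induction k with
    | zero => exact h
    | succ k ih =>
      intro w hw hwh
      have hst : hilb K (r + k) = hilb K (r + k + 1) := by
        rw [hilb_eq_of_le hKs hK1 (show r ≤ r + k by omega),
          hilb_eq_of_le hKs hK1 (show r ≤ r + k + 1 by omega)]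
      obtain ⟨q, hq, v, hv, hvh, l, -, rfl⟩ := mem_span_of_hilb_eq (t := r + k) hKs hst
        (by convert hwh using 1; omega) hw
      have er : r + k + 1 = r + 1 + k := by omega
      rw [er] at hq hvh
      have : u * (∑ i, X i * q i + l * v) = ∑ i, X i * (u * q i) + l * (u * v) := by
        rw [mul_add, Finset.mul_sum]
        congr 1
        · exact Finset.sum_congr rfl fun i _ => by ring
        · ring
      rw [this]
      exact add_mem (Submodule.sum_mem _ fun i _ => Ideal.mul_mem_left _ _ (ih _ (hq i).2 (hq i).1))
        (Ideal.mul_mem_left _ _ (ih _ hv hvh))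
  rw [Submodule.mem_colon]
  intro s hs
  rw [smul_eq_mul, ← sum_homogeneousComponent s, Finset.mul_sum]
  refine Submodule.sum_mem _ fun t _ => ?_
  have hst := homogeneousComponent_isHomogeneous t s
  rcases le_or_gt (r + 1) t with ht | ht
  · obtain ⟨k, hk⟩ := Nat.exists_eq_add_of_le ht
    rw [hk] at hst ⊢
    exact hhigh k _ (hK s hs _) hst
  · refine hI.mem_of_forall_forms (r + 1 - t) fun v hv => ?_
    rw [mul_assoc]
    refine h _ (K.mul_mem_right _ (hK s hs t)) ?_
    have := hst.mul hv
    rwa [show t + (r + 1 - t) = r + 1 by omega] at this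

set_option maxSynthPendingDepth 3 in
/-- The members of a pencil of linked schemes that have the right length have frames that depend
polynomially on the parameter. -/
lemma exists_frame_family {r : ℕ} (hr : 2 ≤ r) {K : Ideal CoordRing} (hK : IsHomog K) (hKs : IsSat K)
    (hK1 : hilb K (r - 1) = hilb K r) {f f' g : CoordRing} (hf : f.IsHomogeneous r)
    (hf' : f'.IsHomogeneous r) (hg : g.IsHomogeneous (r + 2)) (hf0 : f ≠ 0) (hg0 : g ≠ 0)
    (hfg : IsRelPrime f g) {N : ℕ} (hN : 2 ≤ N)
    (hZ : hilb ((Ideal.span {f, g}).colon (K : Set CoordRing)) N = N) :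
    ∃ Φ : ℂ → Forms N →ₗ[ℂ] (Fin N → ℂ), Reg polyFun Φ ∧ Function.Surjective (Φ 0) ∧
      formsIn ((Ideal.span {f, g}).colon (K : Set CoordRing)) N ≤ LinearMap.ker (Φ 0) ∧
      ∀ᶠ s in Filter.cofinite, Function.Surjective (Φ s) ∧
        (f + C s * f' ≠ 0 → IsRelPrime (f + C s * f') g →
          formsIn ((Ideal.span {f + C s * f', g}).colon (K : Set CoordRing)) N ≤
            LinearMap.ker (Φ s)) := by
  have hu : r + N = r + N := rfl
  have hv : r + 2 + (N - 2) = r + N := by omega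
  have hM : N + r = r + N := add_comm _ _
  have hr1 : r - 1 + 1 = r := by omega
  set F : ℂ → Forms r := fun s => ⟨f, hf⟩ + s • ⟨f', hf'⟩ with hFdef
  have hF : ∀ s, (F s : CoordRing) = f + C s * f' := fun s => by
    rw [← smul_eq_C_mul]; rfl
  set G : Forms (r + 2) := ⟨g, hg⟩
  have hFr : Reg polyFun F := (reg_const _).add (Reg.smul id_mem_polyFun (reg_const _))
  have hpair : Reg polyFun fun s => (F s, G) := by
    have h1 := hFr.map (LinearMap.inl ℂ (Forms r) (Forms (r + 2)))
    have h2 := h1.add (reg_const (LinearMap.inr ℂ (Forms r) (Forms (r + 2)) G))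
    simpa using h2
  set L : ℂ → Forms N × Forms (N - 2) →ₗ[ℂ] Forms (r + N) := fun s => combine hu hv (F s, G)
  have hL : Reg polyFun L := hpair.map (combine hu hv)
  have hrange : ∀ s, LinearMap.range (L s) = formsIn (Ideal.span {f + C s * f', g}) (r + N) := by
    intro s
    rw [← hF s]
    exact range_combine hu hv (F s) G
  have hrank : ∀ s, f + C s * f' ≠ 0 → IsRelPrime (f + C s * f') g →
      Module.finrank ℂ (LinearMap.range (L s)) +
        tri (r + N + 1 - (r + (r + 2))) = tri (r + N + 1 - r) + tri (r + N + 1 - (r + 2)) := by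
    intro s h1 h2
    rw [hrange]
    exact finrank_formsIn_span_pair (hF s ▸ (F s).2) hg h1 hg0 h2 _
  have h00 : f + C 0 * f' = f := by simp
  obtain ⟨δ, hδ, hδ0, q, hq, hqk⟩ := exists_cokernel_family hL 0
  have hqk' : ∀ s, δ s ≠ 0 → f + C s * f' ≠ 0 → IsRelPrime (f + C s * f') g →
      LinearMap.ker (q s) = formsIn (Ideal.span {f + C s * f', g}) (r + N) := by
    intro s hs h1 h2
    rw [← hrange]
    refine hqk s hs ?_
    have e1 := hrank s h1 h2
    have e2 := hrank 0 (by rwa [h00]) (by rwa [h00])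
    omega
  -- Membership of `u` in the colon becomes the linear condition that `q s` kills `u w` for all `w`
  -- in `K_r`.
  set T : Forms N →ₗ[ℂ] formsIn K r →ₗ[ℂ] Forms (r + N) :=
    (mulForm hM).compl₂ (formsIn K r).subtype
  set P : ℂ → Forms N →ₗ[ℂ] formsIn K r →ₗ[ℂ] Forms (r + N) := fun s => T.compr₂ (q s)
  have hP : Reg polyFun P := reg_hom fun u => reg_hom fun w => hq.apply (T u w)
  have hPker : ∀ s, δ s ≠ 0 → f + C s * f' ≠ 0 → IsRelPrime (f + C s * f') g →
      LinearMap.ker (P s) =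
        formsIn ((Ideal.span {f + C s * f', g}).colon (K : Set CoordRing)) N := by
    intro s hs h1 h2
    have hmem : ∀ (u : Forms N) (w : formsIn K r), P s u w = 0 ↔
        (u * w.1 : CoordRing) ∈ Ideal.span {f + C s * f', g} := by
      intro u w
      change T u w ∈ LinearMap.ker (q s) ↔ _
      rw [hqk' s hs h1 h2]
      rfl
    ext u
    rw [LinearMap.mem_ker, mem_formsIn]
    constructor
    · intro hu0
      refine mem_colon_of_forall_forms (r := r - 1) hK hKs (by rwa [hr1]) (isSat_span_pair h1 h2)
        fun w hw hwh => ?_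
      rw [hr1] at hwh
      exact (hmem u ⟨⟨w, hwh⟩, hw⟩).1 (by rw [hu0]; rfl)
    · intro hu0
      refine LinearMap.ext fun w => ?_
      exact (hmem u w).2 (Submodule.mem_colon.1 hu0 w.1 w.2)
  have hPker0 := hPker 0 hδ0 (by rwa [h00]) (by rwa [h00])
  rw [h00] at hPker0
  have hfin : Module.finrank ℂ (LinearMap.range (P 0)) = Module.finrank ℂ (Fin N → ℂ) := by
    have h1 := LinearMap.finrank_range_add_finrank_ker (P 0)
    have h2 := hilb_add_finrank ((Ideal.span {f, g}).colon (K : Set CoordRing)) N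
    rw [hPker0, finrank_forms] at h1
    rw [Module.finrank_fin_fun]
    omega
  -- The map `P 0` has rank `N`. A fixed projection onto its image turns the whole family into maps
  -- to `ℂᴺ`, surjective at `0` and hence for almost all `s`.
  obtain ⟨R, hR⟩ := LinearMap.exists_leftInverse_of_injective (LinearMap.range (P 0)).subtype
    (Submodule.ker_subtype _)
  set e := LinearEquiv.ofFinrankEq _ _ hfin
  set Φ : ℂ → Forms N →ₗ[ℂ] (Fin N → ℂ) := fun s => (e.toLinearMap ∘ₗ R) ∘ₗ P s
  have hΦ : Reg polyFun Φ := (reg_const _).comp hP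
  have hΦ0 : Function.Surjective (Φ 0) := by
    intro y
    obtain ⟨x, rfl⟩ := e.surjective y
    obtain ⟨u, hu⟩ := x.2
    refine ⟨u, ?_⟩
    change e (R (P 0 u)) = e x
    rw [hu]
    exact congrArg e (LinearMap.congr_fun hR x)
  have hle : ∀ s, LinearMap.ker (P s) ≤ LinearMap.ker (Φ s) := fun s =>
    LinearMap.ker_le_ker_comp _ _
  obtain ⟨δ', hδ', hδ'0, hδ's, -⟩ := exists_kernel_family hΦ hΦ0
  refine ⟨Φ, hΦ, hΦ0, hPker0 ▸ hle 0, ?_⟩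
  filter_upwards [eventually_ne_zero_of_mem_polyFun hδ hδ0,
    eventually_ne_zero_of_mem_polyFun hδ' hδ'0] with s hs hs'
  exact ⟨hδ's s hs', fun h1 h2 => hPker s hs h1 h2 ▸ hle s⟩

/-- A neighbourhood of `Z` contains a principal open set around the frame `Φ 0`. Its equation pulls
back to a polynomial in `s` that is nonzero at `0`, so all but finitely many members of the pencil
lie in the neighbourhood. -/
lemma locusD_subset_closure {r : ℕ} (hr : 2 ≤ r) :
    locusD (tri (r + 1)) r ⊆ closure (goodLocus r ∩ locusD (tri (r + 1)) r) := by
  intro Z hZ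
  obtain ⟨K, f, f', g, hK, hKs, hK1, hf, hf', hg, hf0, hg0, hfg, hZK, hgen⟩ := exists_pencil hr hZ
  have hN := le_tri_succ r
  obtain ⟨Φ, hΦ, hΦ0, hker0, hΦs⟩ := exists_frame_family hr hK hKs hK1 hf hf' hg hf0 hg0 hfg
    (N := tri (r + 1)) (by omega) (by rw [← hZK, hilb_of_mem_locusD hZ (by omega)])
  rw [← hZK] at hker0
  rw [mem_closure_iff]
  intro V hV hZV
  obtain ⟨F, hF, hF0, hFV⟩ := exists_homFun_of_isOpen hV
    (p := ⟨(Z, Φ 0), hΦ0, (ker_eq_formsIn hΦ0 hker0 (Z.hilb_le _)).1⟩) hZV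
  obtain ⟨s, hs1, ⟨hs2, hs3⟩, hfs, hfgs, W, hW, hWD, hWg⟩ :=
    ((eventually_ne_zero_of_mem_polyFun (comp_mem_of_mem_homFun hΦ hF) hF0).and
      (hΦs.and hgen)).exists
  have hle := hs3 hfs hfgs
  rw [← hW] at hle
  exact ⟨W, hFV ⟨(W, Φ s), hs2, (ker_eq_formsIn hs2 hle (W.hilb_le _)).1⟩ hs1, hWg, hWD⟩

end PlaneLiaison

end

open PlaneLiaison in
theorem mainTheorem1 (r : ℕ) (hr : 3 ≤ r) :
    -- every residual of a member of `D_{r-1}` lies in `D_r`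
    residualFamily r (locusD (tri r) (r - 1)) ⊆ locusD (tri (r + 1)) r ∧
    -- the general member of `D_r` is a residual of a member of `D_{r-1}`
    (∃ U : Set (HilbPoints (tri (r + 1))), IsOpen U ∧
      U ∩ locusD (tri (r + 1)) r ⊆ residualFamily r (locusD (tri r) (r - 1)) ∧
      locusD (tri (r + 1)) r ⊆ closure (U ∩ locusD (tri (r + 1)) r)) ∧
    -- the two families have the same closure
    closure (residualFamily r (locusD (tri r) (r - 1))) = closure (locusD (tri (r + 1)) r) ∧
    -- residuality preserves membership in the extremal divisor
    (∀ (Z : HilbPoints (tri r)) (Z' : HilbPoints (tri (r + 1))), AreResidual (r + 1) Z Z' →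
      ((Z ∈ locusD (tri r) (r - 1) ↔ Z' ∈ locusD (tri (r + 1)) r) ∧
        (1 ≤ Z.h0 (r - 1) ↔ 1 ≤ Z'.h0 r))) := by
  have hsub : residualFamily r (locusD (tri r) (r - 1)) ⊆ locusD (tri (r + 1)) r := by
    rintro Z' ⟨Z, hZ, h⟩
    exact (h.h0_eq (by omega)).trans hZ
  have hgood := goodLocus_inter_subset (r := r) (by omega)
  have hdense := locusD_subset_closure (r := r) (by omega)
  refine ⟨hsub, ⟨goodLocus r, isOpen_goodLocus r, hgood, hdense⟩, ?_, ?_⟩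
  · exact (closure_mono hsub).antisymm
      (closure_minimal (hdense.trans (closure_mono hgood)) isClosed_closure)
  · intro Z Z' h
    have h0 := h.h0_eq (by omega)
    refine ⟨?_, by rw [h0]⟩
    change Z.h0 (r - 1) = 1 ↔ Z'.h0 r = 1
    rw [h0]
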